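/- Let $m\in[1,\infty)$, $p\in(0,1)$ and $q:=1-p$. Let $\mathsf{BS}(p)$ be the standardized Bernoulli distribution, which puts mass $p$ at $\sqrt{q/p}$ and mass $q$ at $-\sqrt{p/q}$, and for each $n$ let $\mathrm{BS}_1,\dots,\mathrm{BS}_n$ be i.i.d. random variables with distribution $\mathsf{BS}(p)$. Let $\mathcal F^3_+$ be the class of all twice continuously differentiable $f\colon\mathbb R\to\mathbb R$ such that $f$ and $f''$ are nondecreasing and convex. Put $$m_*(p):=\frac{1+p+2p^2}{2\left(\sqrt{p-p^2}+2p^2\right)}\ \text{ if } 0<p\le\tfrac12,\qquad m_*(p):=1\ \text{ if } \tfrac12\le p<1.$$ For nonnegative $c_1,\dots,c_n$ put $s^{(m)}(c):=\left(\frac1n\sum_{i=1}^n c_i^{2m}\right)^{1/(2m)}$. For $a,b\in\mathbb R^n$ write $a\succeq b$ if $\sum_i a_i=\sum_i b_i$ and, for each $j\in\{1,\dots,n\}$, the sum of the $j$ largest entries of $a$ is at least the sum of the $j$ largest entries of $b$; a function $Q\colon[0,\infty)^n\to\mathbb R$ is Schur-concave if $Q(a)\le Q(b)$ whenever $a,b\in[0,\infty)^n$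 and $a\succeq b$. Then the following seven statements are equivalent to one another. (I) $m\ge m_*(p)$. (II) For all $f\in\mathcal F^3_+$, all natural $n\ge2$ and all nonnegative $c_1,\dots,c_n$, $$\mathsf E f(c_1\mathrm{BS}_1+\dots+c_n\mathrm{BS}_n)\le\mathsf E f\big(s^{(m)}(c)\,(\mathrm{BS}_1+\dots+\mathrm{BS}_n)\big).$$ (III) The same as (II), but only for $n=2$. (IV) For every natural $n\ge2$ and every $f\in\mathcal F^3_+$, the function $$[0,\infty)^n\ni(a_1,\dots,a_n)\longmapsto\mathsf E f\big(a_1^{1/(2m)}\mathrm{BS}_1+\dots+a_n^{1/(2m)}\mathrm{BS}_n\big)$$ is Schur-concave. (V) The same as (IV), but only for $n=2$. (VI) For every natural $n\ge1$, all independent random variables $X_1,\dots,X_n$ and all positive real numbers $a_i,b_i$ such that, for every $i$, $\mathsf E X_i\le0$, $-a_i\le X_i\le b_i$ a.s. and $b_i/a_i\le q/p$, and for every $f\in\mathcal F^3_+$, the expectation $\mathsf E f(X_1+\dots+X_n)$ is finite and $$\mathsf E f(X_1+\dots+X_n)\le\mathsf E f\big(s\,(\mathrm{BS}_1+\dots+\mathrm{BS}_n)\big),\qquad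 s:=\left(\frac1n\sum_{i=1}^n(a_ib_i)^m\right)^{1/(2m)}.$$ (VII) For every natural $n\ge1$, every supermartingale $(S_0,S_1,\dots)$ relative to a nondecreasing sequence of $\sigma$-algebras $(H_0,H_1,\dots)$ with $S_0\le0$ a.s., all $H_{i-1}$-measurable random variables $A_{i-1},B_{i-1}$ and real numbers $c_i$ ($1\le i\le n$) such that, for every $i\in\{1,\dots,n\}$, almost surely $$A_{i-1}>0,\quad B_{i-1}>0,\quad -A_{i-1}\le S_i-S_{i-1}\le B_{i-1},\quad \sqrt{A_{i-1}B_{i-1}}\le c_i,\quad \frac{B_{i-1}}{A_{i-1}}\le\frac qp,$$ and for every $f\in\mathcal F^3_+$, the expectation $\mathsf E f(S_n)$ is finite and $$\mathsf E f(S_n)\le\mathsf E f\big(s^{(m)}(c)\,(\mathrm{BS}_1+\dots+\mathrm{BS}_n)\big).$$ -/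

import Mathlib

open MeasureTheory ProbabilityTheory

universe u

namespace BernoulliSums

/-- The standardized Bernoulli distribution with parameter `p`: with `q = 1 - p`, it puts mass `p`
at `√(q / p)` and mass `q` at `-√(p / q)`. -/
noncomputable def stdBernoulli (p : ℝ) : Measure ℝ :=
  ENNReal.ofReal p • Measure.dirac (√((1 - p) / p)) +
    ENNReal.ofReal (1 - p) • Measure.dirac (-√(p / (1 - p)))

theorem isProbabilityMeasure_stdBernoulli {p : ℝ} (h0 : 0 ≤ p) (h1 : p ≤ 1) :
    IsProbabilityMeasure (stdBernoulli p) := by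
  constructor
  simp only [stdBernoulli, Measure.add_apply, Measure.smul_apply, measure_univ, smul_eq_mul,
    mul_one]
  rw [← ENNReal.ofReal_add h0 (by linarith)]
  simp

/-- `𝔼 f (c₁ BS₁ + ⋯ + cₙ BSₙ)`, where `BS₁, …, BSₙ` are i.i.d. with law `stdBernoulli p`; their
joint law is the product measure. -/
noncomputable def expBS (p : ℝ) (f : ℝ → ℝ) {n : ℕ} (c : Fin n → ℝ) : ℝ :=
  ∫ x : Fin n → ℝ, f (∑ i, c i * x i) ∂(Measure.pi fun _ : Fin n => stdBernoulli p)

/-- The class of twice continuously differentiable functions `f : ℝ → ℝ` such that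
`f` and `f''` are nondecreasing and convex. -/
def F3 : Set (ℝ → ℝ) :=
  {f | ContDiff ℝ 2 f ∧ Monotone f ∧ ConvexOn ℝ Set.univ f ∧
    Monotone (iteratedDeriv 2 f) ∧ ConvexOn ℝ Set.univ (iteratedDeriv 2 f)}

/-- The critical exponent `m_*(p)`. -/
noncomputable def mStar (p : ℝ) : ℝ :=
  if p ≤ 1 / 2 then (1 + p + 2 * p ^ 2) / (2 * (√(p - p ^ 2) + 2 * p ^ 2)) else 1

/-- The power mean `s^{(m)} = ((1/n) ∑ cᵢ^{2m})^{1/(2m)}`. -/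
noncomputable def sMean (m : ℝ) {n : ℕ} (c : Fin n → ℝ) : ℝ :=
  ((1 / (n : ℝ)) * ∑ i, c i ^ (2 * m)) ^ (1 / (2 * m))

/-- The entries of `a` ordered from the largest to the smallest. -/
noncomputable def sortDesc {n : ℕ} (a : Fin n → ℝ) (i : Fin n) : ℝ :=
  a (Tuple.sort a i.rev)

/-- Schur majorization `a ⪰ b`. -/
def Majorizes {n : ℕ} (a b : Fin n → ℝ) : Prop :=
  ∑ i, a i = ∑ i, b i ∧
    ∀ j : Fin n, ∑ i ∈ Finset.Iic j, sortDesc b i ≤ ∑ i ∈ Finset.Iic j, sortDesc a i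

/-- Schur-concavity of a function on `[0, ∞)ⁿ`. Only the values of `Q` on `[0, ∞)ⁿ` matter. -/
def SchurConcaveOnNonneg {n : ℕ} (Q : (Fin n → ℝ) → ℝ) : Prop :=
  ∀ a b : Fin n → ℝ, (∀ i, 0 ≤ a i) → (∀ i, 0 ≤ b i) → Majorizes a b → Q a ≤ Q b

/-- For all `f ∈ F3` and all nonnegative `c₁, …, cₙ`:
`𝔼 f (c₁ BS₁ + ⋯ + cₙ BSₙ) ≤ 𝔼 f (s^{(m)} (BS₁ + ⋯ + BSₙ))`. -/
def SumBound (p m : ℝ) (n : ℕ) : Prop :=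
  ∀ f ∈ F3, ∀ c : Fin n → ℝ, (∀ i, 0 ≤ c i) →
    expBS p f c ≤ expBS p f (fun _ : Fin n => sMean m c)

/-- For all `f ∈ F3`, the map `(a₁, …, aₙ) ↦ 𝔼 f (∑ aᵢ^{1/(2m)} BSᵢ)` on `[0, ∞)ⁿ` is
Schur-concave. -/
def SumSchurConcave (p m : ℝ) (n : ℕ) : Prop :=
  ∀ f ∈ F3, SchurConcaveOnNonneg fun a : Fin n → ℝ =>
    expBS p f (fun i => a i ^ (1 / (2 * m)))

/-- The bound for `n` independent summands of bounded asymmetry, with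
`s^{(m)} = ((1/n) ∑ (aᵢ bᵢ)^m)^{1/(2m)}`. -/
def IndepBound (p m : ℝ) (n : ℕ) : Prop :=
  ∀ (Ω : Type u) [MeasurableSpace Ω] (P : Measure Ω) [IsProbabilityMeasure P]
    (X : Fin n → Ω → ℝ) (a b : Fin n → ℝ),
    (∀ i, Measurable (X i)) → iIndepFun X P →
    (∀ i, ∫ ω, X i ω ∂P ≤ 0) →
    (∀ i, 0 < a i) → (∀ i, 0 < b i) →
    (∀ i, ∀ᵐ ω ∂P, -a i ≤ X i ω ∧ X i ω ≤ b i) →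
    (∀ i, b i / a i ≤ (1 - p) / p) →
    ∀ f ∈ F3,
      Integrable (fun ω => f (∑ i, X i ω)) P ∧
      ∫ ω, f (∑ i, X i ω) ∂P ≤
        expBS p f (fun _ : Fin n =>
          ((1 / (n : ℝ)) * ∑ i, (a i * b i) ^ m) ^ (1 / (2 * m)))

/-- The bound for `S n`, where `S` is a supermartingale with `S 0 ≤ 0` a.s. whose first `n`
differences have bounded conditional asymmetry. For `i : Fin n`, the functions `A i`, `B i`, `c i`
are the bounds for the difference `S (i + 1) - S i`. -/
def SupermartingaleBound (p m : ℝ) (n : ℕ) : Prop :=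
  ∀ (Ω : Type u) (mΩ : MeasurableSpace Ω) (P : Measure Ω) [IsProbabilityMeasure P]
    (H : Filtration ℕ mΩ) (S : ℕ → Ω → ℝ) (A B : Fin n → Ω → ℝ) (c : Fin n → ℝ),
    Supermartingale S H P → (∀ᵐ ω ∂P, S 0 ω ≤ 0) →
    (∀ i : Fin n, Measurable[H (i : ℕ)] (A i)) → (∀ i : Fin n, Measurable[H (i : ℕ)] (B i)) →
    (∀ i : Fin n, ∀ᵐ ω ∂P, 0 < A i ω ∧ 0 < B i ω ∧
      -A i ω ≤ S ((i : ℕ) + 1) ω - S (i : ℕ) ω ∧ S ((i : ℕ) + 1) ω - S (i : ℕ) ω ≤ B i ω ∧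
      √(A i ω * B i ω) ≤ c i ∧ B i ω / A i ω ≤ (1 - p) / p) →
    ∀ f ∈ F3,
      Integrable (fun ω => f (S n ω)) P ∧
      ∫ ω, f (S n ω) ∂P ≤ expBS p f (fun _ : Fin n => sMean m c)

end BernoulliSums

namespace BernoulliSums

/-! Everything reduces to two summands. Move the coefficients along x = (a + t)^(1/(2m)), y = (a -
t)^(1/(2m)), and put k = 2m - 1, g = f'. For 0 < t < a, the t-derivative of E f(z + x BS₁ + y BS₂)
has the sign of g(b + X) - g(b + Y) - ((X/Y)^k - 1) D. Here b is the lowest atom of the argument, X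
and Y are x and y times the gap between the two atoms of BS, and D = `bsDiff p g b X Y` is a
positive multiple of E g(...) BS₂.

Since f'' is nonnegative, nondecreasing and convex, its chord over [b + Y, b + X] lies above it
there and below it elsewhere. So the extremal f'' is the positive part of a line, and the sign
condition becomes a quadratic inequality in d = X/Y - 1 and the position s of the zero of the line
(`Admissible.sub_le`, `Admissible.quadratic_le`). For p ≤ 1/2, maximising over s leaves a
one-variable inequality (`envelope_le_rpow`). It is tightest as d → 0, where it says k(√(p - p²) +
p) ≥ 1, which is m ≥ m_*(p). For p ≥ 1/2, k ≥ 1 is enough. Robin Hood transfers then give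
Schur-concavity, and majorization of the constant mean vector gives the sum bound.

Conversely, below the critical exponent a truncated cube with its kink at the maximising s makes the
expectation increase as equal coefficients are pulled apart (`exists_stepBS_lt`).

For (VI) and (VII), one bounded increment with controlled asymmetry is dominated by c BS plus a
linear term of nonpositive mean (`F3.le_stepBS_add`). The class `F3` is closed under averaging, so
increments can be replaced one at a time. Scaled Bernoulli variables satisfy the hypotheses of both,
which recovers the two-summand bound. -/

/-! ### The one-variable inequality behind the critical exponent -/

/-- Equality holds at W = r T, which is x = 1 in `envelope_deriv`. In δ = W - r T the difference of
the sides has no constant term and nonnegative coefficients. -/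
theorem envelope_algebra {p r W T : ℝ} (hp : 0 < p) (hp' : p ≤ 1 / 2) (hr : 0 < r)
    (hr2 : r ^ 2 = p - p ^ 2) (hT : 0 < T) (hW : r * T ≤ W) :
    (W + (1 - p) * T) ^ 2 * (r + p) ≤
      W * ((3 - 2 * p) * W + (1 - p) * (1 + 2 * p) * T) := by
  obtain ⟨δ, hδ, rfl⟩ : ∃ δ, 0 ≤ δ ∧ W = r * T + δ := ⟨W - r * T, by linarith, by ring⟩
  have hrh : r ≤ 1 / 2 := by nlinarith [sq_nonneg (p - 1 / 2)]
  have key : (r * T + δ) * ((3 - 2 * p) * (r * T + δ) + (1 - p) * (1 + 2 * p) * T)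
      - (r * T + δ + (1 - p) * T) ^ 2 * (r + p)
      = (1 - p) * (1 - 2 * p + 4 * r) * (T * δ) + (3 - 2 * p - r - p) * δ ^ 2 := by
    linear_combination (T ^ 2 * (-r - p + 1) - 2 * T * δ) * hr2
  have h1 : 0 ≤ (1 - p) * (1 - 2 * p + 4 * r) * (T * δ) := by
    have : 0 ≤ 1 - 2 * p + 4 * r := by linarith
    have : 0 ≤ 1 - p := by linarith
    positivity
  have h2 : 0 ≤ (3 - 2 * p - r - p) * δ ^ 2 := mul_nonneg (by linarith) (sq_nonneg _)
  linarith

/-- This is N'/N - D'/D ≤ k/x with denominators cleared, where N and D are the two factors on the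
right and W is a function of x. Multiplying N D by V = W + (1 - p)(x + 1) and eliminating W² gives a
closed form that `envelope_algebra` can bound. -/
theorem envelope_deriv {p r k W x : ℝ} (hp : 0 < p) (hp' : p ≤ 1 / 2) (hr : 0 < r)
    (hr2 : r ^ 2 = p - p ^ 2) (hk : 1 ≤ k * (r + p)) (hx : 1 ≤ x) (hW0 : 0 < W)
    (hW : W ^ 2 = 4 * p * (1 - p) * x + (1 - p) ^ 2 * (x - 1) ^ 2) :
    x * (4 * p * (W + (1 - p) * (x + 1)) / W) ≤
      k * ((2 * p + (1 + p) * (x - 1) + W) * (2 * p - (1 - p) * (x - 1) + W)) := by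
  have hrT : r * (x + 1) ≤ W := by
    refine (sq_le_sq₀ (by positivity) hW0.le).1 ?_
    have : W ^ 2 - (r * (x + 1)) ^ 2 = (1 - p) * (1 - 2 * p) * (x - 1) ^ 2 := by
      linear_combination hW - (x + 1) ^ 2 * hr2
    have h2 : 0 ≤ (1 - p) * (1 - 2 * p) * (x - 1) ^ 2 :=
      mul_nonneg (mul_nonneg (by linarith) (by linarith)) (sq_nonneg _)
    linarith
  have halg := envelope_algebra hp hp' hr hr2 (by linarith : 0 < x + 1) hrT
  set V := W + (1 - p) * (x + 1) with hV
  have hV0 : 0 < V := by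
    have : 0 < (1 - p) * (x + 1) := mul_pos (by linarith) (by linarith)
    linarith
  have hND : (2 * p + (1 + p) * (x - 1) + W) * (2 * p - (1 - p) * (x - 1) + W) * V
      = 4 * p * x * ((3 - 2 * p) * W + (1 - p) * (1 + 2 * p) * (x + 1)) := by
    rw [hV]
    linear_combination (W + (1 - p) * (x + 1) + 2 * p * x + 2 * p) * hW
  have hND' : 4 * p * x * (V ^ 2 * (r + p)) ≤
      W * ((2 * p + (1 + p) * (x - 1) + W) * (2 * p - (1 - p) * (x - 1) + W)) * V := by
    calc _ ≤ 4 * p * x * (W * ((3 - 2 * p) * W + (1 - p) * (1 + 2 * p) * (x + 1))) := by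
            gcongr
      _ = _ := by linear_combination (-W) * hND
  have h3 : 4 * p * x * V * (r + p) ≤
      W * ((2 * p + (1 + p) * (x - 1) + W) * (2 * p - (1 - p) * (x - 1) + W)) := by
    refine le_of_mul_le_mul_right ?_ hV0
    linarith
  have hk0 : 0 < k := by
    by_contra hk0
    nlinarith
  rw [mul_div_assoc', div_le_iff₀ hW0]
  calc x * (4 * p * V) ≤ k * (r + p) * (x * (4 * p * V)) := by
        refine le_mul_of_one_le_left (by positivity) hk
    _ = k * (4 * p * x * V * (r + p)) := by ring
    _ ≤ k * (W * ((2 * p + (1 + p) * (x - 1) + W) * (2 * p - (1 - p) * (x - 1) + W))) := by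
        gcongr
    _ = _ := by ring

/-- With D the denominator and N = D + 2(x - 1), the claim is log N - log D ≤ k log x. Both sides
vanish at x = 1, and `envelope_deriv` compares the derivatives. -/
theorem envelope_le_rpow {p k x : ℝ} (hp : 0 < p) (hp' : p ≤ 1 / 2)
    (hk : 1 ≤ k * (√(p - p ^ 2) + p)) (hx : 1 ≤ x) {W : ℝ}
    (hW : W = √(4 * p * (1 - p) * x + (1 - p) ^ 2 * (x - 1) ^ 2)) :
    0 < 2 * p - (1 - p) * (x - 1) + W ∧
      2 * (x - 1) / (2 * p - (1 - p) * (x - 1) + W) ≤ x ^ k - 1 := by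
  have hq : 0 < 1 - p := by linarith
  set r := √(p - p ^ 2) with hr
  have hpp : 0 < p - p ^ 2 := by nlinarith
  have hr0 : 0 < r := Real.sqrt_pos.2 hpp
  have hr2 : r ^ 2 = p - p ^ 2 := Real.sq_sqrt hpp.le
  set U : ℝ → ℝ := fun x => 4 * p * (1 - p) * x + (1 - p) ^ 2 * (x - 1) ^ 2 with hU
  have hU0 : ∀ y, 1 ≤ y → 0 < U y := fun y hy => by
    have : 0 < 4 * p * (1 - p) * y := by positivity
    have : 0 ≤ (1 - p) ^ 2 * (y - 1) ^ 2 := by positivity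
    simp only [hU]; linarith
  have hw0 : ∀ y, 1 ≤ y → 0 < √(U y) := fun y hy => Real.sqrt_pos.2 (hU0 y hy)
  have hw2 : ∀ y, 1 ≤ y → √(U y) ^ 2 = U y := fun y hy => Real.sq_sqrt (hU0 y hy).le
  have hD0 : ∀ y, 1 ≤ y → 0 < 2 * p - (1 - p) * (y - 1) + √(U y) := fun y hy => by
    have : (1 - p) * (y - 1) ≤ √(U y) := by
      apply Real.le_sqrt_of_sq_le
      have : 0 < 4 * p * (1 - p) * y := by positivity
      simp only [hU]; nlinarith
    linarith
  have hN0 : ∀ y, 1 ≤ y → 0 < 2 * p + (1 + p) * (y - 1) + √(U y) := fun y hy => by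
    have := hD0 y hy
    nlinarith
  have hUd : ∀ y, HasDerivAt U (4 * p * (1 - p) + 2 * (1 - p) ^ 2 * (y - 1)) y := fun y => by
    have h := ((hasDerivAt_id y).const_mul (4 * p * (1 - p))).add
      ((((hasDerivAt_id y).sub_const 1).pow 2).const_mul ((1 - p) ^ 2))
    refine h.congr_deriv ?_
    simp; ring
  set L : ℝ → ℝ := fun y => k * Real.log y + Real.log (2 * p - (1 - p) * (y - 1) + √(U y))
    - Real.log (2 * p + (1 + p) * (y - 1) + √(U y)) with hL
  have hLd : ∀ y, 1 ≤ y → ∃ l, 0 ≤ l ∧ HasDerivAt L l y := fun y hy => by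
    have hy0 : y ≠ 0 := by positivity
    have hW' := (hUd y).sqrt (hU0 y hy).ne'
    set w := √(U y) with hw
    set w' := (4 * p * (1 - p) + 2 * (1 - p) ^ 2 * (y - 1)) / (2 * w) with hw'
    have hwp : 0 < w := hw0 y hy
    have hDd : HasDerivAt (fun y => 2 * p - (1 - p) * (y - 1) + √(U y)) (-(1 - p) + w') y := by
      have h := ((((hasDerivAt_id y).sub_const 1).const_mul (1 - p)).const_sub (2 * p)).add hW'
      refine h.congr_deriv ?_
      simp
    have hNd : HasDerivAt (fun y => 2 * p + (1 + p) * (y - 1) + √(U y)) (1 + p + w') y := by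
      have h := ((((hasDerivAt_id y).sub_const 1).const_mul (1 + p)).const_add (2 * p)).add hW'
      refine h.congr_deriv ?_
      simp
    have hN := hN0 y hy
    have hD := hD0 y hy
    rw [← hw] at hN hD
    refine ⟨k * y⁻¹ + (-(1 - p) + w') / (2 * p - (1 - p) * (y - 1) + w)
      - (1 + p + w') / (2 * p + (1 + p) * (y - 1) + w), ?_,
      (((Real.hasDerivAt_log hy0).const_mul k).add (hDd.log hD.ne')).sub (hNd.log hN.ne')⟩
    have hmain := envelope_deriv hp hp' hr0 hr2 hk hy hwp (hw2 y hy)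
    have hid : (1 + p + w') * (2 * p - (1 - p) * (y - 1) + w)
        - (-(1 - p) + w') * (2 * p + (1 + p) * (y - 1) + w)
        = 4 * p * (w + (1 - p) * (y + 1)) / w := by
      have h2 := hw2 y hy
      rw [← hw] at h2
      rw [hw']
      field_simp
      simp only [hU] at h2
      linear_combination 4 * h2
    rw [← hid] at hmain
    have e : k * y⁻¹ + (-(1 - p) + w') / (2 * p - (1 - p) * (y - 1) + w)
        - (1 + p + w') / (2 * p + (1 + p) * (y - 1) + w)
        = (k * ((2 * p + (1 + p) * (y - 1) + w) * (2 * p - (1 - p) * (y - 1) + w))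
          - y * ((1 + p + w') * (2 * p - (1 - p) * (y - 1) + w)
        - (-(1 - p) + w') * (2 * p + (1 + p) * (y - 1) + w)))
          / (y * ((2 * p + (1 + p) * (y - 1) + w) * (2 * p - (1 - p) * (y - 1) + w))) := by
      rw [eq_div_iff (by positivity)]
      generalize 2 * p - (1 - p) * (y - 1) + w = D at *
      generalize 2 * p + (1 + p) * (y - 1) + w = N at *
      generalize -(1 - p) + w' = D' at *
      generalize 1 + p + w' = N' at *
      field_simp
      ring
    rw [e]
    exact div_nonneg (by linarith) (by positivity)
  have hmono : MonotoneOn L (Set.Ici 1) := by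
    refine monotoneOn_of_deriv_nonneg (convex_Ici 1) ?_ ?_ ?_
    · intro y hy
      obtain ⟨l, -, h⟩ := hLd y hy
      exact h.continuousAt.continuousWithinAt
    · intro y hy
      rw [interior_Ici] at hy
      obtain ⟨l, -, h⟩ := hLd y (le_of_lt hy)
      exact h.differentiableAt.differentiableWithinAt
    · intro y hy
      rw [interior_Ici] at hy
      obtain ⟨l, h0, h⟩ := hLd y (le_of_lt hy)
      rw [h.deriv]; exact h0
  have hL1 := hmono (Set.mem_Ici.2 le_rfl) (Set.mem_Ici.2 hx) hx
  have hD := hD0 x hx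
  have hN := hN0 x hx
  rw [show √(U x) = W from hW.symm] at hD hN
  refine ⟨hD, ?_⟩
  simp only [hL, sub_self, mul_zero, sub_zero, add_zero, Real.log_one, zero_add] at hL1
  rw [show √(U x) = W from hW.symm] at hL1
  have hx0 : 0 < x := by linarith
  have h4 : 2 * p + (1 + p) * (x - 1) + W ≤ x ^ k * (2 * p - (1 - p) * (x - 1) + W) := by
    rw [← Real.log_le_log_iff hN (by positivity), Real.log_mul (by positivity) hD.ne',
      Real.log_rpow hx0]
    linarith
  rw [div_le_iff₀ hD]
  linarith

/-- The condition on the exponent `k = 2 m - 1` under which the Schur-concavity inequality holds. -/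
def Admissible (p k : ℝ) : Prop :=
  1 ≤ k ∧ (p ≤ 1 / 2 → 1 ≤ k * (√(p - p ^ 2) + p))

theorem Admissible.quadratic_le {p k : ℝ} (hp : 0 < p) (hp1 : p < 1) (hk : Admissible p k)
    {d s : ℝ} (hd : 0 ≤ d) (hs : 0 ≤ s) :
    d ^ 2 + 2 * d * s ≤
      ((1 + d) ^ k - 1) * (p * (1 + 2 * d + 2 * s) + (1 - p) * s ^ 2) := by
  have hq : 0 < 1 - p := by linarith
  have hpos : 0 ≤ p * (1 + 2 * d + 2 * s) + (1 - p) * s ^ 2 := by positivity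
  rcases le_total p (1 / 2) with h | h
  · obtain ⟨hD, he⟩ := envelope_le_rpow hp h (hk.2 h) (by linarith : 1 ≤ 1 + d) rfl
    refine le_trans ?_ (mul_le_mul_of_nonneg_right he hpos)
    rw [div_mul_eq_mul_div, le_div_iff₀ hD]
    rw [add_sub_cancel_left]
    set W := √(4 * p * (1 - p) * (1 + d) + (1 - p) ^ 2 * d ^ 2) with hW
    have hW2 : W ^ 2 = 4 * p * (1 - p) * (1 + d) + (1 - p) ^ 2 * d ^ 2 :=
      Real.sq_sqrt (by positivity)
    -- Maximisation over s: the square (W - (1 - p)(d + 2s))² vanishes exactly at the worst s.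
    have h1 : (d + 2 * s) * W ≤ 2 * p * (1 + d) + (1 - p) / 2 * d ^ 2
        + (1 - p) / 2 * (d + 2 * s) ^ 2 := by
      have : 0 ≤ (W - (1 - p) * (d + 2 * s)) ^ 2 := sq_nonneg _
      refine le_of_mul_le_mul_left ?_ (mul_pos two_pos hq)
      nlinarith
    have := mul_le_mul_of_nonneg_left h1 hd
    nlinarith
  · have h1 : d ≤ (1 + d) ^ k - 1 := by
      have := Real.rpow_le_rpow_of_exponent_le (by linarith : 1 ≤ 1 + d) hk.1
      rw [Real.rpow_one] at this
      linarith
    refine le_trans ?_ (mul_le_mul_of_nonneg_right h1 hpos)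
    -- Multiplied by d, this is the right side minus the left after (1 + d)^k - 1 is replaced by d.
    have : 0 ≤ (2 * p - 1) * d + (2 * p - 1) + (1 - p) * (1 - s) ^ 2 := by
      have : 0 ≤ 2 * p - 1 := by linarith
      positivity
    nlinarith [mul_nonneg hd this]

/-! ### Reduction to quadratics by a chord of the second derivative -/

theorem sub_le_sub_of_hasDerivAt_le {f f' g g' : ℝ → ℝ} {a b : ℝ} (hab : a ≤ b)
    (hf : ∀ x, HasDerivAt f (f' x) x) (hg : ∀ x, HasDerivAt g (g' x) x)
    (h : ∀ x ∈ Set.Icc a b, f' x ≤ g' x) : f b - f a ≤ g b - g a := by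
  have hm : MonotoneOn (fun x => g x - f x) (Set.Icc a b) := by
    refine monotoneOn_of_deriv_nonneg (convex_Icc a b) ?_ ?_ ?_
    · exact fun x _ => ((hg x).sub (hf x)).continuousAt.continuousWithinAt
    · exact fun x _ => ((hg x).sub (hf x)).differentiableAt.differentiableWithinAt
    · intro x hx
      have hd : deriv (fun x => g x - f x) x = g' x - f' x := ((hg x).sub (hf x)).deriv
      rw [hd]
      exact sub_nonneg.2 (h x (interior_subset hx))
  have := hm (Set.left_mem_Icc.2 hab) (Set.right_mem_Icc.2 hab) hab
  simp only at this
  linarith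

theorem hasDerivAt_quadratic (c a l x : ℝ) :
    HasDerivAt (fun y => c * (y - a) + l / 2 * (y - a) ^ 2) (c + l * (x - a)) x := by
  have h := (((hasDerivAt_id x).sub_const a).const_mul c).add
    ((((hasDerivAt_id x).sub_const a).pow 2).const_mul (l / 2))
  refine h.congr_deriv ?_
  simp; ring

/-- The derivative form of the Schur-concavity inequality, after scaling. -/
theorem Admissible.sub_le {p k : ℝ} (hp : 0 < p) (hp1 : p < 1) (hk : Admissible p k)
    {g h : ℝ → ℝ} (hg : ∀ x, HasDerivAt g (h x) x) (h0 : ∀ x, 0 ≤ h x) (hmono : Monotone h)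
    (hconv : ConvexOn ℝ Set.univ h) (a : ℝ) {X Y : ℝ} (hY : 0 < Y) (hXY : Y < X) :
    g (a + X) - g (a + Y) ≤ ((X / Y) ^ k - 1) *
      (p * (g (a + X + Y) - g (a + X)) + (1 - p) * (g (a + Y) - g a)) := by
  obtain ⟨d, hd, rfl⟩ : ∃ d, 0 < d ∧ X = (1 + d) * Y :=
    ⟨X / Y - 1, by rw [sub_pos, lt_div_iff₀ hY]; linarith, by field_simp; ring⟩
  have hq : 0 < 1 - p := by linarith
  rw [mul_div_assoc, div_self hY.ne', mul_one]
  set X := (1 + d) * Y with hX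
  -- The chord of h over [a + Y, a + X] is c + l (x - (a + Y)). Integrating it bounds all three
  -- increments of g.
  set l := (h (a + X) - h (a + Y)) / (X - Y) with hl
  set c := h (a + Y) with hc
  have hXY0 : 0 < X - Y := by linarith
  have hl0 : 0 ≤ l := div_nonneg (sub_nonneg.2 (hmono (by linarith))) hXY0.le
  have hc0 : 0 ≤ c := h0 _
  have hlX : h (a + X) = c + l * (X - Y) := by rw [hl]; field_simp; ring
  clear_value l c X
  have hin : ∀ x ∈ Set.Icc (a + Y) (a + X), h x ≤ c + l * (x - (a + Y)) := by
    intro x hx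
    have := hconv.2 (Set.mem_univ (a + Y)) (Set.mem_univ (a + X))
      (div_nonneg (by linarith [hx.2]) hXY0.le : 0 ≤ (a + X - x) / (X - Y))
      (div_nonneg (by linarith [hx.1]) hXY0.le : 0 ≤ (x - (a + Y)) / (X - Y))
      (by field_simp; ring)
    simp only [smul_eq_mul] at this
    rw [show (a + X - x) / (X - Y) * (a + Y) + (x - (a + Y)) / (X - Y) * (a + X) = x by
      field_simp; ring] at this
    refine this.trans_eq ?_
    rw [← hc, hlX]; field_simp; ring
  have hge : ∀ x, a + X ≤ x → c + l * (x - (a + Y)) ≤ h x := by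
    intro x hx
    have hx0 : 0 < x - (a + Y) := by linarith
    have := hconv.2 (Set.mem_univ (a + Y)) (Set.mem_univ x)
      (div_nonneg (by linarith) hx0.le : 0 ≤ (x - (a + X)) / (x - (a + Y)))
      (div_nonneg (by linarith) hx0.le : 0 ≤ (X - Y) / (x - (a + Y)))
      (by field_simp; ring)
    simp only [smul_eq_mul] at this
    rw [show (x - (a + X)) / (x - (a + Y)) * (a + Y) + (X - Y) / (x - (a + Y)) * x = a + X by
      field_simp; ring, hlX, ← hc, div_mul_eq_mul_div, div_mul_eq_mul_div, ← add_div,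
      le_div_iff₀ hx0] at this
    refine le_of_mul_le_mul_left ?_ hXY0
    nlinarith
  have hle : ∀ x, x ≤ a + Y → c + l * (x - (a + Y)) ≤ h x := by
    intro x hx
    have hx0 : 0 < a + X - x := by linarith
    have := hconv.2 (Set.mem_univ x) (Set.mem_univ (a + X))
      (div_nonneg (by linarith) hx0.le : 0 ≤ (X - Y) / (a + X - x))
      (div_nonneg (by linarith) hx0.le : 0 ≤ (a + Y - x) / (a + X - x))
      (by field_simp; ring)
    simp only [smul_eq_mul] at this
    rw [show (X - Y) / (a + X - x) * x + (a + Y - x) / (a + X - x) * (a + X) = a + Y by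
      field_simp; ring, hlX, ← hc, div_mul_eq_mul_div, div_mul_eq_mul_div, ← add_div,
      le_div_iff₀ hx0] at this
    refine le_of_mul_le_mul_left ?_ hXY0
    nlinarith
  have gm : Monotone g := monotone_of_hasDerivAt_nonneg hg h0
  have hquad := hasDerivAt_quadratic c (a + Y) l
  have b1 : g (a + X) - g (a + Y) ≤ c * (d * Y) + l / 2 * (d * Y) ^ 2 := by
    have := sub_le_sub_of_hasDerivAt_le (by linarith) hg hquad hin
    refine this.trans_eq ?_
    rw [hX]; ring
  have b2 : c * Y + l / 2 * ((1 + 2 * d) * Y ^ 2) ≤ g (a + X + Y) - g (a + X) := by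
    have := sub_le_sub_of_hasDerivAt_le (by linarith : a + X ≤ a + X + Y) hquad hg
      (fun x hx => hge x hx.1)
    refine le_trans (le_of_eq ?_) this
    rw [hX]; ring
  have he : 0 ≤ (1 + d) ^ k - 1 := by
    have := Real.one_le_rpow (by linarith : 1 ≤ 1 + d) (by linarith [hk.1] : 0 ≤ k)
    linarith
  -- The chord line is nonnegative on all of [a, a + Y] exactly when l Y ≤ c.
  rcases le_or_gt (l * Y) c with hcl | hcl
  · have b3 : c * Y - l / 2 * Y ^ 2 ≤ g (a + Y) - g a := by
      have := sub_le_sub_of_hasDerivAt_le (by linarith : a ≤ a + Y) hquad hg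
        (fun x hx => hle x hx.2)
      refine le_trans (le_of_eq ?_) this
      ring
    refine b1.trans (le_trans ?_ (mul_le_mul_of_nonneg_left (add_le_add
      (mul_le_mul_of_nonneg_left b2 hp.le) (mul_le_mul_of_nonneg_left b3 hq.le)) he))
    have hdk : d ≤ (1 + d) ^ k - 1 := by
      have := Real.rpow_le_rpow_of_exponent_le (by linarith : 1 ≤ 1 + d) hk.1
      rw [Real.rpow_one] at this
      linarith
    -- Split the line as l (x - a), the case s = 1, plus the constant c - l Y ≥ 0. The constant part
    -- needs only d ≤ (1 + d)^k - 1.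
    have h1 := hk.quadratic_le hp hp1 hd.le (zero_le_one' ℝ)
    have h2 := mul_le_mul_of_nonneg_left h1 (by positivity : 0 ≤ l / 2 * Y ^ 2)
    have h3 := mul_le_mul_of_nonneg_right hdk (mul_nonneg (sub_nonneg.2 hcl) hY.le)
    nlinarith
  · have hl1 : 0 < l := by
      by_contra hl2
      have : l = 0 := le_antisymm (not_lt.1 hl2) hl0
      rw [this] at hcl
      linarith
    -- The line vanishes at a + Y - s Y. Below that point only monotonicity of g is used.
    obtain ⟨s, hs⟩ : ∃ s, c = l * s * Y := ⟨c / (l * Y), by field_simp⟩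
    have hs0 : 0 ≤ s := by
      by_contra hs0
      have := mul_pos hl1 hY
      nlinarith
    have hs1 : s ≤ 1 := by
      by_contra hs1
      have := mul_pos hl1 hY
      nlinarith
    have b3 : l / 2 * (s ^ 2 * Y ^ 2) ≤ g (a + Y) - g a := by
      have h1 := sub_le_sub_of_hasDerivAt_le
        (by nlinarith [mul_nonneg hs0 hY.le] : a + Y - s * Y ≤ a + Y) hquad hg
        (fun x hx => hle x hx.2)
      have h2 : g a ≤ g (a + Y - s * Y) :=
        gm (by nlinarith)
      have e : c * (a + Y - (a + Y)) + l / 2 * (a + Y - (a + Y)) ^ 2 -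
        (c * (a + Y - s * Y - (a + Y)) + l / 2 * (a + Y - s * Y - (a + Y)) ^ 2)
          = l / 2 * (s ^ 2 * Y ^ 2) := by rw [hs]; ring
      rw [e] at h1
      linarith
    refine b1.trans (le_trans ?_ (mul_le_mul_of_nonneg_left (add_le_add
      (mul_le_mul_of_nonneg_left b2 hp.le) (mul_le_mul_of_nonneg_left b3 hq.le)) he))
    have h1 := mul_le_mul_of_nonneg_left (hk.quadratic_le hp hp1 hd.le hs0)
      (by positivity : 0 ≤ l / 2 * Y ^ 2)
    rw [hs]
    refine le_trans (le_of_eq ?_) (h1.trans (le_of_eq ?_)) <;> ring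

/-! ### Derivatives and closure properties of `F3` -/

theorem F3.hasDerivAt {f : ℝ → ℝ} (hf : f ∈ F3) (x : ℝ) : HasDerivAt f (deriv f x) x :=
  (hf.1.differentiable (by norm_num)).differentiableAt.hasDerivAt

theorem F3.hasDerivAt_deriv {f : ℝ → ℝ} (hf : f ∈ F3) (x : ℝ) :
    HasDerivAt (deriv f) (iteratedDeriv 2 f x) x := by
  have h := hf.1.differentiable_iteratedDeriv 1 (by norm_num)
  rw [iteratedDeriv_one] at h
  rw [iteratedDeriv_succ, iteratedDeriv_one]
  exact h.differentiableAt.hasDerivAt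

theorem F3.continuous {f : ℝ → ℝ} (hf : f ∈ F3) : Continuous f := hf.1.continuous

theorem F3.deriv_nonneg {f : ℝ → ℝ} (hf : f ∈ F3) (x : ℝ) : 0 ≤ deriv f x :=
  hf.2.1.deriv_nonneg

theorem F3.monotone_deriv {f : ℝ → ℝ} (hf : f ∈ F3) : Monotone (deriv f) := by
  have := hf.2.2.1.monotoneOn_deriv (fun x _ => (F3.hasDerivAt hf x).differentiableAt)
  exact monotoneOn_univ.1 this

theorem F3.iteratedDeriv_two_nonneg {f : ℝ → ℝ} (hf : f ∈ F3) (x : ℝ) :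
    0 ≤ iteratedDeriv 2 f x := by
  rw [← (F3.hasDerivAt_deriv hf x).deriv]
  exact (F3.monotone_deriv hf).deriv_nonneg

theorem F3.comp_add_const {f : ℝ → ℝ} (hf : f ∈ F3) (a : ℝ) : (fun x => f (x + a)) ∈ F3 := by
  have e : iteratedDeriv 2 (fun x => f (x + a)) = fun x => iteratedDeriv 2 f (x + a) := by
    rw [iteratedDeriv_comp_add_const]
  have hc : ∀ g : ℝ → ℝ, ConvexOn ℝ Set.univ g → ConvexOn ℝ Set.univ fun x => g (x + a) := by
    intro g hg
    have := hg.translate_left a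
    simpa [Function.comp_def] using this
  refine ⟨hf.1.comp (contDiff_id.add contDiff_const), fun x y h => hf.2.1 (by linarith),
    hc f hf.2.2.1, ?_, ?_⟩
  · rw [e]; exact fun x y h => hf.2.2.2.1 (by linarith)
  · rw [e]; exact hc _ hf.2.2.2.2

theorem F3.add_smul {f g : ℝ → ℝ} (hf : f ∈ F3) (hg : g ∈ F3) {a b : ℝ} (ha : 0 ≤ a)
    (hb : 0 ≤ b) : (fun x => a * f x + b * g x) ∈ F3 := by
  have e : iteratedDeriv 2 (fun x => a * f x + b * g x) =
      fun x => a * iteratedDeriv 2 f x + b * iteratedDeriv 2 g x := by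
    funext x
    have h := iteratedDeriv_add (n := 2) (x := x) (f := fun x => a * f x) (g := fun x => b * g x)
      (contDiff_const.mul hf.1).contDiffAt (contDiff_const.mul hg.1).contDiffAt
    rw [iteratedDeriv_const_mul_field, iteratedDeriv_const_mul_field] at h
    exact h
  refine ⟨(contDiff_const.mul hf.1).add (contDiff_const.mul hg.1),
    (hf.2.1.const_mul ha).add (hg.2.1.const_mul hb),
    (hf.2.2.1.smul ha).add (hg.2.2.1.smul hb), ?_, ?_⟩
  · rw [e]; exact (hf.2.2.2.1.const_mul ha).add (hg.2.2.2.1.const_mul hb)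
  · rw [e]; exact (hf.2.2.2.2.smul ha).add (hg.2.2.2.2.smul hb)

/-! ### Bernoulli averages as iterated one-step averages -/

/-- `stepBS p c f x = 𝔼 f (x + c BS)`. -/
noncomputable def stepBS (p c : ℝ) (f : ℝ → ℝ) (x : ℝ) : ℝ :=
  p * f (x + c * √((1 - p) / p)) + (1 - p) * f (x + c * -√(p / (1 - p)))

theorem stepBS_mem_F3 {p : ℝ} (hp : 0 ≤ p) (hp1 : p ≤ 1) (c : ℝ) {f : ℝ → ℝ} (hf : f ∈ F3) :
    stepBS p c f ∈ F3 :=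
  F3.add_smul (F3.comp_add_const hf _) (F3.comp_add_const hf _) hp (by linarith)

theorem integral_stdBernoulli {p : ℝ} (hp : 0 ≤ p) (hp1 : p ≤ 1) (g : ℝ → ℝ) :
    ∫ x, g x ∂(stdBernoulli p) = p * g (√((1 - p) / p)) + (1 - p) * g (-√(p / (1 - p))) := by
  have hi : ∀ a : ℝ, Integrable g (Measure.dirac a) := fun a => by
    apply integrable_dirac
    exact enorm_lt_top
  rw [stdBernoulli, integral_add_measure ((hi _).smul_measure (by simp))
    ((hi _).smul_measure (by simp)), integral_smul_measure, integral_smul_measure,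
    integral_dirac, integral_dirac, ENNReal.toReal_ofReal hp,
    ENNReal.toReal_ofReal (by linarith), smul_eq_mul, smul_eq_mul]

theorem ae_stdBernoulli {p : ℝ} {s : ℝ → Prop} (h1 : s (√((1 - p) / p)))
    (h2 : s (-√(p / (1 - p)))) : ∀ᵐ x ∂(stdBernoulli p), s x := by
  rw [stdBernoulli, ae_add_measure_iff]
  exact ⟨Measure.ae_smul_measure (by simpa using h1) _,
    Measure.ae_smul_measure (by simpa using h2) _⟩

theorem exists_ae_abs_le_stdBernoulli (p : ℝ) : ∃ R : ℝ, ∀ᵐ x ∂(stdBernoulli p), |x| ≤ R :=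
  ⟨max |√((1 - p) / p)| |-√(p / (1 - p))|, ae_stdBernoulli (le_max_left _ _) (le_max_right _ _)⟩

theorem integrable_pi_of_continuous {n : ℕ} {μ : Fin n → Measure ℝ}
    [∀ i, IsProbabilityMeasure (μ i)] (hμ : ∀ i, ∃ R : ℝ, ∀ᵐ x ∂(μ i), |x| ≤ R)
    {F : (Fin n → ℝ) → ℝ} (hF : Continuous F) : Integrable F (Measure.pi μ) := by
  choose R hR using hμ
  have hK : IsCompact (Set.univ.pi fun i => Set.Icc (-R i) (R i)) :=
    isCompact_univ_pi fun i => isCompact_Icc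
  obtain ⟨C, hC⟩ := hK.exists_bound_of_continuousOn hF.continuousOn
  refine Integrable.of_bound hF.aestronglyMeasurable C ?_
  have : ∀ᵐ x ∂(Measure.pi μ), ∀ i, |x i| ≤ R i := by
    rw [ae_all_iff]
    intro i
    exact (Measure.quasiMeasurePreserving_eval μ i).ae (hR i)
  filter_upwards [this] with x hx
  exact hC x fun i _ => abs_le.1 (hx i)

theorem integral_pi_succ {n : ℕ} {μ : Fin (n + 1) → Measure ℝ} [∀ i, IsProbabilityMeasure (μ i)]
    {F : (Fin (n + 1) → ℝ) → ℝ} (hF : Integrable F (Measure.pi μ)) :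
    ∫ x, F x ∂(Measure.pi μ) =
      ∫ y, ∫ x, F (Fin.cons x y) ∂(μ 0) ∂(Measure.pi fun i => μ (Fin.succ i)) := by
  have h := (measurePreserving_piFinSuccAbove μ 0).symm
  have hF' := (h.integrable_comp_emb (MeasurableEquiv.measurableEmbedding _)).2 hF
  rw [← h.integral_comp']
  have := integral_prod_symm _ hF'
  simp only [Function.comp_def, MeasurableEquiv.piFinSuccAbove_symm_apply, Fin.insertNthEquiv,
    Fin.zero_succAbove, Equiv.coe_fn_mk, Fin.insertNth_zero] at this ⊢
  exact this

theorem expBS_zero (p : ℝ) (f : ℝ → ℝ) (c : Fin 0 → ℝ) : expBS p f c = f 0 := by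
  rw [expBS, Measure.pi_of_empty, integral_dirac]
  simp

theorem expBS_succ {p : ℝ} (hp : 0 ≤ p) (hp1 : p ≤ 1) {f : ℝ → ℝ} (hf : Continuous f) {n : ℕ}
    (c : Fin (n + 1) → ℝ) :
    expBS p f c = expBS p (stepBS p (c 0) f) (Fin.tail c) := by
  have := isProbabilityMeasure_stdBernoulli hp hp1
  rw [expBS, integral_pi_succ, expBS]
  · congr 1
    funext y
    rw [integral_stdBernoulli hp hp1]
    simp only [Fin.sum_univ_succ, Fin.cons_zero, Fin.cons_succ, stepBS, Fin.tail, add_comm]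
  · exact integrable_pi_of_continuous (fun _ => exists_ae_abs_le_stdBernoulli p)
      (by fun_prop)

theorem expBS_comp_perm {p : ℝ} (hp : 0 ≤ p) (hp1 : p ≤ 1) (f : ℝ → ℝ) {n : ℕ}
    (c : Fin n → ℝ) (σ : Equiv.Perm (Fin n)) : expBS p f (c ∘ σ) = expBS p f c := by
  have := isProbabilityMeasure_stdBernoulli hp hp1
  have h := measurePreserving_piCongrLeft (fun _ : Fin n => stdBernoulli p) σ
  rw [eq_comm, expBS, expBS, ← h.integral_comp']
  congr 1
  funext x
  congr 1
  refine (Equiv.sum_comp σ _).symm.trans ?_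
  refine Finset.sum_congr rfl fun i _ => ?_
  rw [MeasurableEquiv.coe_piCongrLeft, Equiv.piCongrLeft_apply_apply, Function.comp_apply]

theorem expBS_mono {p : ℝ} (hp : 0 ≤ p) (hp1 : p ≤ 1) {f g : ℝ → ℝ} (hf : Continuous f)
    (hg : Continuous g) (hfg : ∀ x, f x ≤ g x) {n : ℕ} (c : Fin n → ℝ) :
    expBS p f c ≤ expBS p g c := by
  have := isProbabilityMeasure_stdBernoulli hp hp1
  exact integral_mono
    (integrable_pi_of_continuous (fun _ => exists_ae_abs_le_stdBernoulli p) (by fun_prop))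
    (integrable_pi_of_continuous (fun _ => exists_ae_abs_le_stdBernoulli p) (by fun_prop))
    (fun x => hfg _)

theorem expBS_two {p : ℝ} (hp : 0 ≤ p) (hp1 : p ≤ 1) {f : ℝ → ℝ} (hf : Continuous f)
    (c : Fin 2 → ℝ) : expBS p f c = stepBS p (c 1) (stepBS p (c 0) f) 0 := by
  rw [expBS_succ hp hp1 hf, expBS_succ hp hp1 (by unfold stepBS; fun_prop), expBS_zero]
  rfl

theorem sqrt_div_mul_self {p : ℝ} (hp : 0 < p) (hp1 : p < 1) :
    p * √((1 - p) / p) = √(p - p ^ 2) ∧ (1 - p) * √(p / (1 - p)) = √(p - p ^ 2) := by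
  have hq : 0 < 1 - p := by linarith
  constructor
  · rw [← Real.sqrt_sq hp.le, ← Real.sqrt_mul (sq_nonneg _), Real.sqrt_sq hp.le]
    congr 1; field_simp
  · rw [← Real.sqrt_sq hq.le, ← Real.sqrt_mul (sq_nonneg _), Real.sqrt_sq hq.le]
    congr 1; field_simp

/-! ### Transfers between two coefficients -/

/-- Proportional to `𝔼 g(x BS₁ + y BS₂) BS₂`, where `a = -(x + y) √(p / q)` and `X`, `Y` are `x`, `y`
times the distance of the two atoms of `stdBernoulli p`. -/
noncomputable def bsDiff (p : ℝ) (g : ℝ → ℝ) (a X Y : ℝ) : ℝ :=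
  p * (g (a + X + Y) - g (a + X)) + (1 - p) * (g (a + Y) - g a)

/-- Chain rule over the four atoms. Replacing BS₂ by BS₁ as the weight of f' adds f'(a + X) - f'(a +
Y), because p + (1 - p) = 1. -/
theorem hasDerivAt_stepBS_stepBS {p : ℝ} (hp : 0 < p) (hp1 : p < 1) {f : ℝ → ℝ} (hf : f ∈ F3)
    (z : ℝ) {x y : ℝ → ℝ} {x' y' t : ℝ} (hx : HasDerivAt x x' t) (hy : HasDerivAt y y' t)
    {a X Y : ℝ} (ha : a = z - (x t + y t) * √(p / (1 - p)))
    (hX : X = x t * (√((1 - p) / p) + √(p / (1 - p))))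
    (hY : Y = y t * (√((1 - p) / p) + √(p / (1 - p)))) :
    HasDerivAt (fun t => stepBS p (y t) (stepBS p (x t) f) z)
      (√(p - p ^ 2) * (x' * (bsDiff p (deriv f) a X Y + (deriv f (a + X) - deriv f (a + Y)))
        + y' * bsDiff p (deriv f) a X Y)) t := by
  obtain ⟨h1, h2⟩ := sqrt_div_mul_self hp hp1
  set α := √((1 - p) / p)
  set β := √(p / (1 - p))
  set r := √(p - p ^ 2)
  have D : ∀ u v : ℝ, HasDerivAt (fun t => f (z + y t * u + x t * v))
      (deriv f (z + y t * u + x t * v) * (y' * u + x' * v)) t := fun u v =>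
    (F3.hasDerivAt hf _).comp t (((hy.mul_const u).const_add z).add (hx.mul_const v))
  have h := ((((D α α).const_mul p).add ((D α (-β)).const_mul (1 - p))).const_mul p).add
    ((((D (-β) α).const_mul p).add ((D (-β) (-β)).const_mul (1 - p))).const_mul (1 - p))
  refine h.congr_deriv ?_
  have e1 : z + y t * α + x t * α = a + X + Y := by rw [ha, hX, hY]; ring
  have e2 : z + y t * α + x t * -β = a + Y := by rw [ha, hY]; ring
  have e3 : z + y t * -β + x t * α = a + X := by rw [ha, hX]; ring
  have e4 : z + y t * -β + x t * -β = a := by rw [ha]; ring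
  rw [e1, e2, e3, e4, bsDiff]
  generalize deriv f (a + X + Y) = g1
  generalize deriv f (a + X) = g2
  generalize deriv f (a + Y) = g3
  generalize deriv f a = g4
  linear_combination (p * g1 * (y' + x') + (1 - p) * (g3 * y' + g2 * x')) * h1
    - (p * g3 * x' + p * g2 * y' + (1 - p) * g4 * (y' + x')) * h2

theorem continuous_stepBS {p : ℝ} {f : ℝ → ℝ} (hf : Continuous f) (c : ℝ) :
    Continuous (stepBS p c f) := by
  unfold stepBS; fun_prop

theorem hasDerivAt_rpow_pair {m a t : ℝ} (hm : 1 ≤ m) (h : t ∈ Set.Ioo (-a) a) :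
    HasDerivAt (fun t => (a + t) ^ (1 / (2 * m)))
      (1 / (2 * m) * ((a + t) ^ (1 / (2 * m))) ^ (-(2 * m - 1))) t ∧
    HasDerivAt (fun t => (a - t) ^ (1 / (2 * m)))
      (-(1 / (2 * m) * ((a - t) ^ (1 / (2 * m))) ^ (-(2 * m - 1)))) t := by
  have e : 1 / (2 * m) * -(2 * m - 1) = 1 / (2 * m) - 1 := by field_simp; ring
  have h1 : 0 < a + t := by linarith [h.1]
  have h2 : 0 < a - t := by linarith [h.2]
  constructor
  · have := ((hasDerivAt_id t).const_add a).rpow_const (p := 1 / (2 * m)) (Or.inl h1.ne')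
    refine this.congr_deriv ?_
    rw [← Real.rpow_mul h1.le, e]
    simp
  · have := ((hasDerivAt_id t).const_sub a).rpow_const (p := 1 / (2 * m)) (Or.inl h2.ne')
    refine this.congr_deriv ?_
    rw [← Real.rpow_mul h2.le, e]
    simp

theorem Admissible.stepBS_transfer {p m : ℝ} (hp : 0 < p) (hp1 : p < 1) (hm : 1 ≤ m)
    (hk : Admissible p (2 * m - 1)) {f : ℝ → ℝ} (hf : f ∈ F3) (a z : ℝ) :
    AntitoneOn (fun t => stepBS p ((a - t) ^ (1 / (2 * m)))
      (stepBS p ((a + t) ^ (1 / (2 * m))) f) z) (Set.Icc 0 a) := by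
  have hm0 : 0 < 1 / (2 * m) := by positivity
  have hfc := F3.continuous hf
  have hd : ∀ t ∈ Set.Ioo 0 a, ∃ l, l ≤ 0 ∧ HasDerivAt (fun t => stepBS p ((a - t) ^ (1 / (2 * m)))
      (stepBS p ((a + t) ^ (1 / (2 * m))) f) z) l t := by
    intro t ht
    obtain ⟨hx, hy⟩ := hasDerivAt_rpow_pair hm ⟨by linarith [ht.1, ht.2], ht.2⟩
    refine ⟨_, ?_, hasDerivAt_stepBS_stepBS hp hp1 hf z hx hy rfl rfl rfl⟩
    have hx0 : 0 < (a + t) ^ (1 / (2 * m)) := Real.rpow_pos_of_pos (by linarith [ht.1, ht.2]) _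
    have hy0 : 0 < (a - t) ^ (1 / (2 * m)) := Real.rpow_pos_of_pos (by linarith [ht.1, ht.2]) _
    have hxy : (a - t) ^ (1 / (2 * m)) < (a + t) ^ (1 / (2 * m)) :=
      Real.rpow_lt_rpow (by linarith [ht.1, ht.2]) (by linarith [ht.1, ht.2]) hm0
    set x := (a + t) ^ (1 / (2 * m))
    set y := (a - t) ^ (1 / (2 * m))
    set w := √((1 - p) / p) + √(p / (1 - p)) with hw
    have hw0 : 0 < w := add_pos_of_pos_of_nonneg
      (Real.sqrt_pos.2 (div_pos (by linarith) hp)) (Real.sqrt_nonneg _)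
    set b := z - (x + y) * √(p / (1 - p)) with hb
    -- The common gap w between the atoms cancels in X/Y, so the power is that of x/y.
    have key := hk.sub_le hp hp1 (F3.hasDerivAt_deriv hf) (F3.iteratedDeriv_two_nonneg hf)
      hf.2.2.2.1 hf.2.2.2.2 b (mul_pos hy0 hw0) (mul_lt_mul_of_pos_right hxy hw0)
    change _ ≤ _ * bsDiff p (deriv f) b (x * w) (y * w) at key
    rw [mul_div_mul_right _ _ hw0.ne', Real.div_rpow hx0.le hy0.le] at key
    refine mul_nonpos_of_nonneg_of_nonpos (Real.sqrt_nonneg _) ?_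
    rw [Real.rpow_neg hx0.le, Real.rpow_neg hy0.le]
    have hxk : 0 < x ^ (2 * m - 1) := Real.rpow_pos_of_pos hx0 _
    have hyk : 0 < y ^ (2 * m - 1) := Real.rpow_pos_of_pos hy0 _
    have h3 := mul_le_mul_of_nonneg_left key (by positivity :
      0 ≤ 1 / (2 * m) * (x ^ (2 * m - 1))⁻¹)
    have e : 1 / (2 * m) * (x ^ (2 * m - 1))⁻¹ *
        ((x ^ (2 * m - 1) / y ^ (2 * m - 1) - 1) * bsDiff p (deriv f) b (x * w) (y * w))
        = 1 / (2 * m) * ((y ^ (2 * m - 1))⁻¹ - (x ^ (2 * m - 1))⁻¹) *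
          bsDiff p (deriv f) b (x * w) (y * w) := by
      field_simp
    linarith
  refine antitoneOn_of_deriv_nonpos (convex_Icc 0 a) ?_ ?_ ?_
  · have h1 : Continuous fun t : ℝ => (a + t) ^ (1 / (2 * m)) :=
      (continuous_const.add continuous_id).rpow_const fun _ => Or.inr hm0.le
    have h2 : Continuous fun t : ℝ => (a - t) ^ (1 / (2 * m)) :=
      (continuous_const.sub continuous_id).rpow_const fun _ => Or.inr hm0.le
    unfold stepBS
    exact Continuous.continuousOn (by fun_prop)
  · intro t ht
    rw [interior_Icc] at ht
    obtain ⟨l, -, h⟩ := hd t ht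
    exact h.differentiableAt.differentiableWithinAt
  · intro t ht
    rw [interior_Icc] at ht
    obtain ⟨l, h0, h⟩ := hd t ht
    rw [h.deriv]; exact h0

/-! ### Truncated cubes and necessity of the critical exponent -/

theorem hasDerivAt_max_pow (t : ℝ) (n : ℕ) (x : ℝ) :
    HasDerivAt (fun x => max (x - t) 0 ^ (n + 2)) ((n + 2) * max (x - t) 0 ^ (n + 1)) x := by
  have hne : ∀ y ≠ t, HasDerivAt (fun x => max (x - t) 0 ^ (n + 2))
      ((n + 2) * max (y - t) 0 ^ (n + 1)) y := by
    intro y hy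
    rcases lt_or_gt_of_ne hy with h | h
    · have : (fun x : ℝ => max (x - t) 0 ^ (n + 2)) =ᶠ[nhds y] fun _ => 0 := by
        filter_upwards [Iio_mem_nhds h] with x hx
        rw [max_eq_right (by linarith [Set.mem_Iio.1 hx])]
        simp
      rw [max_eq_right (by linarith)]
      simpa using (hasDerivAt_const y (0 : ℝ)).congr_of_eventuallyEq this
    · have : (fun x : ℝ => max (x - t) 0 ^ (n + 2)) =ᶠ[nhds y] fun x => (x - t) ^ (n + 2) := by
        filter_upwards [Ioi_mem_nhds h] with x hx
        rw [max_eq_left (by linarith [Set.mem_Ioi.1 hx])]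
      rw [max_eq_left (by linarith)]
      have h2 := ((hasDerivAt_id y).sub_const t).pow (n + 2)
      refine (h2.congr_of_eventuallyEq this).congr_deriv ?_
      simp
  rcases eq_or_ne x t with rfl | hx
  -- At the kink the derivative is the limit of the nearby derivatives.
  · exact hasDerivAt_of_hasDerivAt_of_ne (g := fun y => (n + 2) * max (y - x) 0 ^ (n + 1)) hne
      (by fun_prop) (by fun_prop)
  · exact hne x hx

theorem deriv_max_pow_three (t : ℝ) :
    deriv (fun x : ℝ => max (x - t) 0 ^ 3) = fun x => 3 * max (x - t) 0 ^ 2 := by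
  funext x
  rw [(hasDerivAt_max_pow t 1 x).deriv]
  norm_num

theorem iteratedDeriv_max_pow_three (t : ℝ) :
    iteratedDeriv 2 (fun x : ℝ => max (x - t) 0 ^ 3) = fun x => 6 * max (x - t) 0 := by
  rw [iteratedDeriv_succ, iteratedDeriv_one, deriv_max_pow_three]
  funext x
  have := ((hasDerivAt_max_pow t 0 x).const_mul 3).deriv
  simp only [zero_add, pow_one, CharP.cast_eq_zero] at this
  rw [this]; ring

theorem max_pow_three_mem_F3 (t : ℝ) : (fun x : ℝ => max (x - t) 0 ^ 3) ∈ F3 := by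
  have hm1 : Monotone fun x : ℝ => max (x - t) 0 := fun x y h =>
    max_le_max (by linarith) le_rfl
  have hc1 : ConvexOn ℝ Set.univ fun x : ℝ => max (x - t) 0 :=
    ((convexOn_id convex_univ).sub (concaveOn_const t convex_univ)).sup
      (convexOn_const 0 convex_univ)
  refine ⟨?_, fun x y h => pow_le_pow_left₀ (le_max_right _ _) (hm1 h) 3,
    hc1.pow (fun x _ => le_max_right _ _) 3, ?_, ?_⟩
  · rw [show (2 : WithTop ℕ∞) = 1 + 1 by norm_num, contDiff_succ_iff_deriv]
    refine ⟨fun x => (hasDerivAt_max_pow t 1 x).differentiableAt, by simp, ?_⟩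
    rw [contDiff_one_iff_deriv]
    constructor
    · rw [deriv_max_pow_three]
      exact fun x => ((hasDerivAt_max_pow t 0 x).const_mul 3).differentiableAt
    · have := iteratedDeriv_max_pow_three t
      rw [iteratedDeriv_succ, iteratedDeriv_one] at this
      rw [this]
      fun_prop
  · rw [iteratedDeriv_max_pow_three]
    exact hm1.const_mul (by norm_num)
  · rw [iteratedDeriv_max_pow_three]
    exact hc1.smul (by norm_num)

theorem rpow_sub_rpow_le {x y k : ℝ} (hk : 1 ≤ k) (hy : 0 < y) (hxy : y < x) :
    x ^ k - y ^ k ≤ k * x ^ (k - 1) * (x - y) := by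
  have hx : 0 < x := by linarith
  have h := one_add_mul_self_le_rpow_one_add (s := y / x - 1)
    (by linarith [div_pos hy hx]) hk
  rw [add_sub_cancel, Real.div_rpow hy.le hx.le] at h
  have hxk : 0 < x ^ k := Real.rpow_pos_of_pos hx _
  rw [le_div_iff₀ hxk] at h
  have e : x ^ (k - 1) = x ^ k / x := by rw [Real.rpow_sub_one hx.ne']
  rw [e]
  have e2 : (1 + k * (y / x - 1)) * x ^ k = x ^ k - k * (x ^ k / x) * (x - y) := by
    field_simp; ring
  linarith

/-- If `2 m - 1` is below the critical value, then equal coefficients are not optimal. -/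
theorem exists_stepBS_lt {p m : ℝ} (hp : 0 < p) (hp' : p ≤ 1 / 2) (hm : 1 ≤ m)
    (hk : (2 * m - 1) * (√(p - p ^ 2) + p) < 1) :
    ∃ f ∈ F3, ∃ t ∈ Set.Ioo (0 : ℝ) 1, stepBS p 1 (stepBS p 1 f) 0 <
      stepBS p ((1 - t) ^ (1 / (2 * m))) (stepBS p ((1 + t) ^ (1 / (2 * m))) f) 0 := by
  have hp1 : p < 1 := by linarith
  have hq : 0 < 1 - p := by linarith
  have hm0 : 0 < 1 / (2 * m) := by positivity
  obtain ⟨hα, hβ⟩ := sqrt_div_mul_self hp hp1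
  set α := √((1 - p) / p) with hαd
  set β := √(p / (1 - p)) with hβd
  set r := √(p - p ^ 2) with hrd
  have hβ0 : 0 < β := Real.sqrt_pos.2 (div_pos hp hq)
  have hα0 : 0 < α := Real.sqrt_pos.2 (div_pos hq hp)
  have hr0 : 0 < r := by rw [← hα]; positivity
  have hβ1 : β ≤ 1 := by
    exact Real.sqrt_le_iff.2 ⟨zero_le_one, by rw [one_pow, div_le_one hq]; linarith⟩
  have hβ2 : (1 - p) * β ^ 2 = p := by
    rw [hβd, Real.sq_sqrt (by positivity)]; field_simp
  set w := α + β with hw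
  have hw0 : 0 < w := by positivity
  set k := 2 * m - 1 with hkd
  have hk1 : 1 ≤ k := by linarith
  -- At t = 0 the lowest atom is -2β and X = Y = w, so this kink corresponds to s = β. That is the
  -- maximiser of 2s / (p(1 + 2s) + (1 - p)s²), the ratio left when d → 0; β ≤ 1 keeps the kink at
  -- or above the lowest atom.
  set T := -2 * β + (1 - β) * w with hT
  set f : ℝ → ℝ := fun x => max (x - T) 0 ^ 3 with hfd
  have hf : f ∈ F3 := max_pow_three_mem_F3 T
  have hg : deriv f = fun x => 3 * max (x - T) 0 ^ 2 := deriv_max_pow_three T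
  have hh : iteratedDeriv 2 f = fun x => 6 * max (x - T) 0 := iteratedDeriv_max_pow_three T
  set x : ℝ → ℝ := fun t => (1 + t) ^ (1 / (2 * m)) with hx
  set y : ℝ → ℝ := fun t => (1 - t) ^ (1 / (2 * m)) with hy
  have hxc : Continuous x :=
    (continuous_const.add continuous_id).rpow_const fun _ => Or.inr hm0.le
  have hyc : Continuous y :=
    (continuous_const.sub continuous_id).rpow_const fun _ => Or.inr hm0.le
  have hx0 : x 0 = 1 := by simp [hx]
  have hy0 : y 0 = 1 := by simp [hy]
  -- The infinitesimal form of the reversed transfer inequality. At t = 0 it reads k(r + p) < 1, and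
  -- continuity extends it to nearby t.
  have hlim : ∀ᶠ t in nhds (0 : ℝ), k * x t ^ (k - 1) *
      bsDiff p (deriv f) (0 - (x t + y t) * β) (x t * w) (y t * w) <
      y t ^ k * (w * iteratedDeriv 2 f (0 - (x t + y t) * β + y t * w)) := by
    refine ContinuousAt.eventually_lt ?_ ?_ ?_
    · refine (continuousAt_const.mul (hxc.continuousAt.rpow_const (Or.inr (by linarith)))).mul ?_
      rw [hg]
      unfold bsDiff
      fun_prop
    · refine (hyc.continuousAt.rpow_const (Or.inr (by linarith))).mul ?_
      rw [hh]
      fun_prop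
    · rw [hx0, hy0, Real.one_rpow, Real.one_rpow, hh, hg, bsDiff]
      beta_reduce
      rw [show 0 - (1 + 1) * β + 1 * w + 1 * w - T = w * (1 + β) by rw [hT]; ring,
        show 0 - (1 + 1) * β + 1 * w - T = w * β by rw [hT]; ring,
        show 0 - (1 + 1) * β - T = -((1 - β) * w) by rw [hT]; ring,
        max_eq_left (by positivity), max_eq_left (by positivity),
        max_eq_right (neg_nonpos.2 (mul_nonneg (by linarith) hw0.le))]
      have e1 : p * (1 + β) = β * (r + p) := by rw [← hβ]; linear_combination (-1 : ℝ) * hβ2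
      have e2 : k * 1 * (p * (3 * (w * (1 + β)) ^ 2 - 3 * (w * β) ^ 2) +
          (1 - p) * (3 * (w * β) ^ 2 - 3 * 0 ^ 2)) = 6 * w ^ 2 * β * (k * (r + p)) := by
        linear_combination (3 * k * w ^ 2) * hβ2 + 6 * k * w ^ 2 * e1
      have e3 : 6 * w ^ 2 * β * (k * (r + p)) < 6 * w ^ 2 * β * 1 := by gcongr
      linarith
  obtain ⟨ε, hε, hball⟩ := Metric.eventually_nhds_iff.1 hlim
  set δ := min ε 1 with hδ
  have hδ0 : 0 < δ := lt_min hε one_pos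
  set φ : ℝ → ℝ := fun t => stepBS p (y t) (stepBS p (x t) f) 0 with hφ
  have hd : ∀ t ∈ Set.Ioo 0 δ, 0 < deriv φ t := by
    intro t ht
    have ht1 : t < 1 := ht.2.trans_le (min_le_right _ _)
    have hlt := hball (y := t) (by
      rw [Real.dist_0_eq_abs, abs_of_pos ht.1]; exact ht.2.trans_le (min_le_left _ _))
    obtain ⟨hxd, hyd⟩ := hasDerivAt_rpow_pair (a := 1) hm ⟨by linarith [ht.1], ht1⟩
    rw [(hasDerivAt_stepBS_stepBS hp hp1 hf 0 hxd hyd rfl rfl rfl).deriv]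
    refine mul_pos hr0 ?_
    have hxp : 0 < x t := Real.rpow_pos_of_pos (by linarith [ht.1]) _
    have hyp : 0 < y t := Real.rpow_pos_of_pos (by linarith [ht.1]) _
    have hxy : y t < x t := Real.rpow_lt_rpow (by linarith) (by linarith [ht.1]) hm0
    change 0 < 1 / (2 * m) * (x t) ^ (-k) * (bsDiff p (deriv f) (0 - (x t + y t) * β) (x t * w)
      (y t * w) + (deriv f (0 - (x t + y t) * β + x t * w)
        - deriv f (0 - (x t + y t) * β + y t * w)))
      + -(1 / (2 * m) * (y t) ^ (-k)) * bsDiff p (deriv f) (0 - (x t + y t) * β) (x t * w)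
      (y t * w)
    generalize x t = x at *
    generalize y t = y at *
    set b := 0 - (x + y) * β with hb
    have hslope : iteratedDeriv 2 f (b + y * w) * ((x - y) * w) ≤
        deriv f (b + x * w) - deriv f (b + y * w) := by
      have h1 : b + y * w ≤ b + x * w := by nlinarith
      have := sub_le_sub_of_hasDerivAt_le h1
        (fun u => hasDerivAt_quadratic (iteratedDeriv 2 f (b + y * w)) (b + y * w) 0 u)
        (F3.hasDerivAt_deriv hf)
        (fun u hu => by simpa using hf.2.2.2.1 hu.1)
      refine le_trans (le_of_eq ?_) this
      ring
    have hDnn : 0 ≤ bsDiff p (deriv f) b (x * w) (y * w) := by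
      have hmono := F3.monotone_deriv hf
      have hyw : 0 < y * w := by positivity
      exact add_nonneg (mul_nonneg hp.le (sub_nonneg.2 (hmono (by linarith))))
        (mul_nonneg hq.le (sub_nonneg.2 (hmono (by linarith))))
    generalize bsDiff p (deriv f) b (x * w) (y * w) = D at *
    generalize deriv f (b + x * w) - deriv f (b + y * w) = Δ at *
    generalize iteratedDeriv 2 f (b + y * w) = H at *
    -- This bound on x^k - y^k and `hslope` both carry a factor x - y, so the infinitesimal
    -- inequality yields the finite one.
    have hpow := rpow_sub_rpow_le hk1 hyp hxy
    have hxk : 0 < x ^ k := Real.rpow_pos_of_pos hxp _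
    have hyk : 0 < y ^ k := Real.rpow_pos_of_pos hyp _
    have h1 : (x ^ k - y ^ k) * D ≤ k * x ^ (k - 1) * (x - y) * D :=
      mul_le_mul_of_nonneg_right hpow hDnn
    have h2 := mul_lt_mul_of_pos_right hlt (sub_pos.2 hxy)
    have h3 := mul_le_mul_of_nonneg_left hslope hyk.le
    have h4 : 0 < y ^ k * (D + Δ) - x ^ k * D := by linarith
    rw [Real.rpow_neg hxp.le, Real.rpow_neg hyp.le]
    have e : 1 / (2 * m) * (x ^ k)⁻¹ * (D + Δ) + -(1 / (2 * m) * (y ^ k)⁻¹) * D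
        = 1 / (2 * m) * (y ^ k * (D + Δ) - x ^ k * D) / (x ^ k * y ^ k) := by
      field_simp
      ring
    rw [e]
    positivity
  have hmono : StrictMonoOn φ (Set.Icc 0 (δ / 2)) := by
    refine strictMonoOn_of_deriv_pos (convex_Icc _ _) ?_ ?_
    · have := F3.continuous hf
      simp only [hφ]
      unfold stepBS
      exact Continuous.continuousOn (by fun_prop)
    · intro t ht
      rw [interior_Icc] at ht
      exact hd t ⟨ht.1, by linarith [ht.2]⟩
  have hlt := hmono (Set.left_mem_Icc.2 (by positivity)) (Set.right_mem_Icc.2 (by positivity))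
    (by positivity : (0 : ℝ) < δ / 2)
  refine ⟨f, hf, δ / 2, ⟨by positivity, ?_⟩, ?_⟩
  · have := min_le_right ε 1; linarith
  · simp only [hφ, hx0, hy0] at hlt
    exact hlt

/-- For p ≤ 1/2 and r = √(p - p²), the identity (1 + p + 2p²)(r + p) = (1 + r + p)(r + 2p²) shows
that 2 m_*(p) - 1 = 1/(r + p). -/
theorem mStar_le_iff {p m : ℝ} (hp : 0 < p) (hm : 1 ≤ m) :
    mStar p ≤ m ↔ Admissible p (2 * m - 1) := by
  rw [mStar, Admissible]
  split_ifs with h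
  · have hpp : 0 < p - p ^ 2 := by nlinarith
    have hr0 : 0 < √(p - p ^ 2) := Real.sqrt_pos.2 hpp
    have hr2 : √(p - p ^ 2) ^ 2 = p - p ^ 2 := Real.sq_sqrt hpp.le
    generalize √(p - p ^ 2) = r at *
    have e : (1 + p + 2 * p ^ 2) * (r + p) = (1 + r + p) * (r + 2 * p ^ 2) := by
      linear_combination (-1 : ℝ) * hr2
    have hA : 0 < r + p := by positivity
    have hB : 0 < r + 2 * p ^ 2 := by positivity
    rw [div_le_iff₀ (by positivity)]
    have e2 : (m * (2 * (r + 2 * p ^ 2)) - (1 + p + 2 * p ^ 2)) * (r + p)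
        = ((2 * m - 1) * (r + p) - 1) * (r + 2 * p ^ 2) := by linear_combination (-1 : ℝ) * e
    constructor
    · intro h1
      refine ⟨by linarith, fun _ => ?_⟩
      have := mul_nonneg (sub_nonneg.2 h1) hA.le
      rw [e2] at this
      linarith [nonneg_of_mul_nonneg_left this hB]
    · intro h1
      have := mul_nonneg (sub_nonneg.2 (h1.2 h)) hB.le
      rw [← e2] at this
      linarith [nonneg_of_mul_nonneg_left this hA]
  · exact ⟨fun _ => ⟨by linarith, fun h' => absurd h' h⟩, fun _ => hm⟩

/-- If the two-summand bound holds for positive coefficients, then `m` is at least `m_*(p)`. -/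
theorem mStar_le_of_bound_two {p m : ℝ} (hp : 0 < p) (hp1 : p < 1) (hm : 1 ≤ m)
    (h : ∀ f ∈ F3, ∀ c : Fin 2 → ℝ, (∀ i, 0 < c i) →
      expBS p f c ≤ expBS p f (fun _ : Fin 2 => sMean m c)) : mStar p ≤ m := by
  rw [mStar_le_iff hp hm]
  refine ⟨by linarith, fun hp' => ?_⟩
  by_contra! hk
  obtain ⟨f, hf, t, ht, hlt⟩ := exists_stepBS_lt hp hp' hm hk
  have h1 : 0 < 1 + t := by linarith [ht.1]
  have h2 : 0 < 1 - t := by linarith [ht.2]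
  have := h f hf ![(1 + t) ^ (1 / (2 * m)), (1 - t) ^ (1 / (2 * m))] (by
    intro i
    fin_cases i
    · exact Real.rpow_pos_of_pos h1 _
    · exact Real.rpow_pos_of_pos h2 _)
  have hs : sMean m ![(1 + t) ^ (1 / (2 * m)), (1 - t) ^ (1 / (2 * m))] = 1 := by
    have hm0 : 1 / (2 * m) * (2 * m) = 1 := by field_simp
    simp only [sMean, Fin.sum_univ_two, Matrix.cons_val_zero, Matrix.cons_val_one]
    rw [← Real.rpow_mul h1.le, ← Real.rpow_mul h2.le, hm0, Real.rpow_one, Real.rpow_one]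
    norm_num
  rw [hs, expBS_two hp.le hp1.le (F3.continuous hf), expBS_two hp.le hp1.le (F3.continuous hf)]
    at this
  exact absurd this (not_le.2 hlt)

/-! ### Majorization and Schur-concavity -/

/-- A function that does not decrease under Robin Hood transfers is monotone for majorization;
here majorization is stated through partial sums, with `b` antitone. -/
theorem le_of_sum_Iic_le {n : ℕ} {Q : (Fin n → ℝ) → ℝ}
    (hQ : ∀ (a : Fin n → ℝ) (j k : Fin n) (δ : ℝ), (∀ i, 0 ≤ a i) → j ≠ k → 0 ≤ δ →
      a k + δ ≤ a j - δ →
      Q a ≤ Q fun i => a i - (if i = j then δ else 0) + if i = k then δ else 0)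
    {a b : Fin n → ℝ} (ha : ∀ i, 0 ≤ a i) (hb : ∀ i, 0 ≤ b i) (hanti : Antitone b)
    (hsum : ∑ i, a i = ∑ i, b i)
    (hle : ∀ j, ∑ i ∈ Finset.Iic j, b i ≤ ∑ i ∈ Finset.Iic j, a i) : Q a ≤ Q b := by
  induction hN : (Finset.univ.filter fun i => a i ≠ b i).card using Nat.strong_induction_on
    generalizing a with
  | _ N ih =>
  by_cases hab : a = b
  · rw [hab]
  have hne : (Finset.univ.filter fun i => a i < b i).Nonempty := by
    by_contra h
    rw [Finset.not_nonempty_iff_eq_empty, Finset.filter_eq_empty_iff] at h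
    have h' : ∀ i ∈ Finset.univ, b i ≤ a i := fun i hi => not_lt.1 (h hi)
    have := (Finset.sum_eq_sum_iff_of_le h').1 hsum.symm
    exact hab (funext fun i => (this i (Finset.mem_univ i)).symm)
  set k := (Finset.univ.filter fun i => a i < b i).min' hne with hk
  have hak : a k < b k := (Finset.mem_filter.1 (Finset.min'_mem _ hne)).2
  have hlt : ∀ i, i < k → b i ≤ a i := by
    intro i hi
    by_contra h
    have hmem : i ∈ Finset.univ.filter fun i => a i < b i :=
      Finset.mem_filter.2 ⟨Finset.mem_univ i, not_le.1 h⟩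
    have := Finset.min'_le _ i hmem
    exact absurd hi (not_lt.2 this)
  -- k is the first deficient index. Without a surplus before it, the partial sum of a up to k would
  -- be below that of b.
  obtain ⟨j, hjk, hj⟩ : ∃ j, j < k ∧ b j < a j := by
    by_contra! h
    refine absurd (hle k) (not_le.2 (Finset.sum_lt_sum ?_ ⟨k, Finset.mem_Iic.2 le_rfl, hak⟩))
    intro i hi
    rcases (Finset.mem_Iic.1 hi).lt_or_eq with h1 | h1
    · exact h i h1
    · rw [h1]; exact hak.le
  -- The largest transfer that overshoots neither target. It makes a and b agree at j or at k, so
  -- the number of disagreements drops.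
  set δ := min (a j - b j) (b k - a k) with hδ
  have hδ0 : 0 < δ := lt_min (by linarith) (by linarith)
  have hδ1 : δ ≤ a j - b j := min_le_left _ _
  have hδ2 : δ ≤ b k - a k := min_le_right _ _
  have hbjk := hanti hjk.le
  refine (hQ a j k δ ha hjk.ne hδ0.le (by linarith)).trans ?_
  have hsumS : ∀ s : Finset (Fin n), ∑ i ∈ s, (a i - (if i = j then δ else 0) +
      if i = k then δ else 0) = ∑ i ∈ s, a i - (if j ∈ s then δ else 0) +
        if k ∈ s then δ else 0 := by
    intro s
    rw [Finset.sum_add_distrib, Finset.sum_sub_distrib, Finset.sum_ite_eq', Finset.sum_ite_eq']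
  refine ih _ ?_ ?_ ?_ ?_ rfl
  · rw [← hN]
    refine Finset.card_lt_card ⟨?_, ?_⟩
    · intro i hi
      simp only [Finset.mem_filter, Finset.mem_univ, true_and] at hi ⊢
      by_cases h1 : i = j
      · rw [h1]; exact hj.ne'
      by_cases h2 : i = k
      · rw [h2]; exact hak.ne
      simpa [h1, h2] using hi
    · intro hsub
      rcases min_choice (a j - b j) (b k - a k) with h | h
      · have := hsub (Finset.mem_filter.2 ⟨Finset.mem_univ j, hj.ne'⟩)
        simp only [Finset.mem_filter, Finset.mem_univ, true_and, if_true, if_neg hjk.ne] at this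
        exact this (by rw [hδ, h]; ring)
      · have := hsub (Finset.mem_filter.2 ⟨Finset.mem_univ k, hak.ne⟩)
        simp only [Finset.mem_filter, Finset.mem_univ, true_and, if_true, if_neg hjk.ne'] at this
        exact this (by rw [hδ, h]; ring)
  · intro i
    have := ha i
    have := hb j
    split_ifs with h1 h2 <;> [skip; rw [h1]; skip; skip] <;> linarith
  · rw [hsumS]
    simpa using hsum
  · intro l
    rw [hsumS]
    have := hle l
    by_cases h1 : k ≤ l
    · rw [if_pos (Finset.mem_Iic.2 (hjk.le.trans h1)), if_pos (Finset.mem_Iic.2 h1)]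
      linarith
    · rw [if_neg (mt Finset.mem_Iic.1 h1)]
      by_cases h2 : j ≤ l
      · rw [if_pos (Finset.mem_Iic.2 h2)]
        -- Between j and k only the loss δ is felt. All terms a i - b i up to l are nonnegative, and
        -- the one at j alone is at least δ.
        have := Finset.single_le_sum (f := fun i => a i - b i) (s := Finset.Iic l) (a := j)
          (fun i hi => sub_nonneg.2 (hlt i ((Finset.mem_Iic.1 hi).trans_lt (not_le.1 h1))))
          (Finset.mem_Iic.2 h2)
        rw [Finset.sum_sub_distrib] at this
        linarith
      · rw [if_neg (mt Finset.mem_Iic.1 h2)]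
        linarith

theorem exists_perm_zero_one {n : ℕ} {j k : Fin (n + 2)} (h : j ≠ k) :
    ∃ σ : Equiv.Perm (Fin (n + 2)), σ 0 = j ∧ σ 1 = k := by
  refine ⟨Equiv.swap 0 j * Equiv.swap 1 (Equiv.swap 0 j k), ?_, ?_⟩
  · have h1 : (0 : Fin (n + 2)) ≠ Equiv.swap 0 j k := by
      intro h0
      apply h
      rw [eq_comm, Equiv.swap_apply_eq_iff, Equiv.swap_apply_left] at h0
      exact h0.symm
    rw [Equiv.Perm.mul_apply, Equiv.swap_apply_of_ne_of_ne (by simp) h1, Equiv.swap_apply_left]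
  · rw [Equiv.Perm.mul_apply, Equiv.swap_apply_left, Equiv.swap_apply_self]

/-- Permute j and k to the first two places and average over them first. The remaining summands
enter only as a shift z, so the two-coefficient comparison applies pointwise. -/
theorem Admissible.expBS_transfer {p m : ℝ} (hp : 0 < p) (hp1 : p < 1) (hm : 1 ≤ m)
    (hk : Admissible p (2 * m - 1)) {f : ℝ → ℝ} (hf : f ∈ F3) {n : ℕ} (a : Fin n → ℝ)
    (j k : Fin n) (δ : ℝ) (ha : ∀ i, 0 ≤ a i) (hjk : j ≠ k) (hδ : 0 ≤ δ)
    (h : a k + δ ≤ a j - δ) :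
    expBS p f (fun i => a i ^ (1 / (2 * m))) ≤
      expBS p f fun i => (a i - (if i = j then δ else 0) + if i = k then δ else 0)
        ^ (1 / (2 * m)) := by
  obtain ⟨n, rfl⟩ : ∃ n', n = n' + 2 := by
    refine ⟨n - 2, ?_⟩
    have := j.isLt
    have := k.isLt
    have : (j : ℕ) ≠ k := fun h => hjk (Fin.ext h)
    omega
  obtain ⟨σ, h0, h1⟩ := exists_perm_zero_one hjk
  have hfc := F3.continuous hf
  have hs : ∀ c d : ℝ, Continuous (stepBS p d (stepBS p c f)) := fun c d =>
    continuous_stepBS (continuous_stepBS hfc c) d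
  rw [← expBS_comp_perm hp.le hp1.le f (fun i => a i ^ (1 / (2 * m))) σ,
    ← expBS_comp_perm hp.le hp1.le f (fun i => (a i - (if i = j then δ else 0) +
      if i = k then δ else 0) ^ (1 / (2 * m))) σ,
    expBS_succ hp.le hp1.le hfc, expBS_succ hp.le hp1.le (continuous_stepBS hfc _),
    expBS_succ hp.le hp1.le hfc, expBS_succ hp.le hp1.le (continuous_stepBS hfc _)]
  have htail : Fin.tail (Fin.tail ((fun i => (a i - (if i = j then δ else 0) +
      if i = k then δ else 0) ^ (1 / (2 * m))) ∘ σ)) =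
      Fin.tail (Fin.tail ((fun i => a i ^ (1 / (2 * m))) ∘ σ)) := by
    funext i
    have e1 : σ i.succ.succ ≠ j := by
      rw [← h0]; exact σ.injective.ne (Fin.succ_ne_zero _)
    have e2 : σ i.succ.succ ≠ k := by
      rw [← h1, ← Fin.succ_zero_eq_one]
      exact σ.injective.ne ((Fin.succ_injective _).ne (Fin.succ_ne_zero _))
    simp [Fin.tail, e1, e2]
  rw [htail]
  refine expBS_mono hp.le hp1.le (hs _ _) (hs _ _) (fun z => ?_) _
  have key := hk.stepBS_transfer hp hp1 hm hf ((a j + a k) / 2) z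
    (⟨by linarith, by linarith [ha k]⟩ : (a j - a k) / 2 - δ ∈ Set.Icc 0 ((a j + a k) / 2))
    (⟨by linarith, by linarith [ha k]⟩ : (a j - a k) / 2 ∈ Set.Icc 0 ((a j + a k) / 2))
    (by linarith)
  simp only [Fin.tail, Function.comp_apply, Fin.succ_zero_eq_one, h0, h1, if_true, if_neg hjk,
    if_neg hjk.symm, sub_zero, add_zero]
  beta_reduce at key
  rw [show (a j + a k) / 2 - (a j - a k) / 2 = a k by ring,
    show (a j + a k) / 2 + (a j - a k) / 2 = a j by ring,
    show (a j + a k) / 2 - ((a j - a k) / 2 - δ) = a k + δ by ring,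
    show (a j + a k) / 2 + ((a j - a k) / 2 - δ) = a j - δ by ring] at key
  exact key

theorem sortDesc_eq_comp {n : ℕ} (a : Fin n → ℝ) :
    sortDesc a = a ∘ (Tuple.sort a * Fin.revPerm : Equiv.Perm (Fin n)) := rfl

theorem sum_sortDesc {n : ℕ} (a : Fin n → ℝ) : ∑ i, sortDesc a i = ∑ i, a i := by
  rw [sortDesc_eq_comp]
  exact Equiv.sum_comp (Tuple.sort a * Fin.revPerm : Equiv.Perm (Fin n)) a

theorem sortDesc_nonneg {n : ℕ} {a : Fin n → ℝ} (ha : ∀ i, 0 ≤ a i) (i : Fin n) :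
    0 ≤ sortDesc a i := ha _

theorem antitone_sortDesc {n : ℕ} (a : Fin n → ℝ) : Antitone (sortDesc a) :=
  fun _ _ h => Tuple.monotone_sort a (Fin.rev_le_rev.2 h)

theorem Admissible.sumSchurConcave {p m : ℝ} (hp : 0 < p) (hp1 : p < 1) (hm : 1 ≤ m)
    (hk : Admissible p (2 * m - 1)) (n : ℕ) : SumSchurConcave p m n := by
  intro f hf a b ha hb hab
  have hsort : ∀ a : Fin n → ℝ, expBS p f (fun i => a i ^ (1 / (2 * m))) =
      expBS p f (fun i => sortDesc a i ^ (1 / (2 * m))) := by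
    intro a
    rw [← expBS_comp_perm hp.le hp1.le f (fun i => a i ^ (1 / (2 * m)))
      (Tuple.sort a * Fin.revPerm), sortDesc_eq_comp]
    rfl
  simp only
  rw [hsort a, hsort b]
  exact le_of_sum_Iic_le (Q := fun a => expBS p f fun i => a i ^ (1 / (2 * m)))
    (hk.expBS_transfer hp hp1 hm hf) (sortDesc_nonneg ha) (sortDesc_nonneg hb) (antitone_sortDesc b)
    (by rw [sum_sortDesc, sum_sortDesc]; exact hab.1) hab.2

/-- Chebyshev's sum inequality for the decreasing rearrangement and the indicator of an initial
segment. -/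
theorem majorizes_mean {n : ℕ} (a : Fin n → ℝ) :
    Majorizes a fun _ => (1 / (n : ℝ)) * ∑ i, a i := by
  rcases Nat.eq_zero_or_pos n with rfl | hn
  · exact ⟨by simp, fun j => j.elim0⟩
  have hn' : (0 : ℝ) < n := by exact_mod_cast hn
  refine ⟨by simp; field_simp, fun j => ?_⟩
  have hmono : Monovary (sortDesc a) fun i => if i ∈ Finset.Iic j then (1 : ℝ) else 0 := by
    intro i k hik
    apply antitone_sortDesc a
    by_contra h
    simp only [Finset.mem_Iic] at hik
    split_ifs at hik with h1 h2 h2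
    · exact lt_irrefl _ hik
    · linarith
    · exact h (h2.trans (not_le.1 h1).le)
    · exact lt_irrefl _ hik
  have := hmono.sum_mul_sum_le_card_mul_sum
  rw [sum_sortDesc] at this
  simp only [mul_ite, mul_one, mul_zero, Finset.sum_ite_mem, Finset.univ_inter, Fintype.card_fin]
    at this
  simp only [sortDesc]
  rw [Finset.sum_const, nsmul_eq_mul]
  simp only [Finset.sum_const, nsmul_eq_mul, mul_one] at this
  rw [← mul_le_mul_iff_right₀ hn']
  refine le_trans (le_of_eq ?_) this
  field_simp

theorem SumSchurConcave.sumBound {p m : ℝ} (hm : 1 ≤ m) {n : ℕ} (h : SumSchurConcave p m n) :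
    SumBound p m n := by
  intro f hf c hc
  have hpow : ∀ i, 0 ≤ c i ^ (2 * m) := fun i => Real.rpow_nonneg (hc i) _
  have := h f hf (fun i => c i ^ (2 * m)) (fun _ => (1 / (n : ℝ)) * ∑ i, c i ^ (2 * m)) hpow
    (fun _ => mul_nonneg (by positivity) (Finset.sum_nonneg fun i _ => hpow i))
    (majorizes_mean _)
  simp only at this
  have e : ∀ i, (c i ^ (2 * m)) ^ (1 / (2 * m)) = c i := fun i => by
    rw [← Real.rpow_mul (hc i), mul_one_div_cancel (by positivity), Real.rpow_one]
  simp only [e] at this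
  exact this

/-! ### Domination of one bounded increment -/

/-- The first-order Taylor remainder divided by y² is a weighted average of f''(v + t y) over t in
[0, 1], hence nondecreasing in y. The product form also covers y = 0 and w = 0. -/
theorem F3.taylor_quotient_le {f : ℝ → ℝ} (hf : f ∈ F3) (v : ℝ) {y w : ℝ} (hyw : y ≤ w) :
    (f (v + y) - f v - deriv f v * y) * w ^ 2 ≤ (f (v + w) - f v - deriv f v * w) * y ^ 2 := by
  have hfd : ∀ c t : ℝ, HasDerivAt (fun t => f (v + t * c) - deriv f v * (t * c))
      (c * (deriv f (v + t * c) - deriv f v)) t := by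
    intro c t
    have h1 : HasDerivAt (fun t => t * c) c t := by
      simpa using (hasDerivAt_id t).mul_const c
    have := ((F3.hasDerivAt hf (v + t * c)).comp t (h1.const_add v)).sub
      (h1.const_mul (deriv f v))
    refine this.congr_deriv ?_
    ring
  have hgd : ∀ c t : ℝ, HasDerivAt (fun t => c * (deriv f (v + t * c) - deriv f v))
      (c ^ 2 * iteratedDeriv 2 f (v + t * c)) t := by
    intro c t
    have h1 : HasDerivAt (fun t => t * c) c t := by
      simpa using (hasDerivAt_id t).mul_const c
    have := ((((F3.hasDerivAt_deriv hf (v + t * c)).comp t (h1.const_add v))).sub_const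
      (deriv f v)).const_mul c
    refine this.congr_deriv ?_
    ring
  have h1 : ∀ t : ℝ, 0 ≤ t → w ^ 2 * (y * (deriv f (v + t * y) - deriv f v)) ≤
      y ^ 2 * (w * (deriv f (v + t * w) - deriv f v)) := by
    intro t ht
    have := sub_le_sub_of_hasDerivAt_le ht (fun t => (hgd y t).const_mul (w ^ 2))
      (fun t => (hgd w t).const_mul (y ^ 2)) (fun t ht => by
        have : iteratedDeriv 2 f (v + t * y) ≤ iteratedDeriv 2 f (v + t * w) :=
          hf.2.2.2.1 (by nlinarith [ht.1])
        have := mul_le_mul_of_nonneg_left this (by positivity : 0 ≤ w ^ 2 * y ^ 2)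
        linarith)
    simpa using this
  have := sub_le_sub_of_hasDerivAt_le zero_le_one (fun t => (hfd y t).const_mul (w ^ 2))
      (fun t => (hfd w t).const_mul (y ^ 2)) (fun t ht => h1 t ht.1)
  simp only [one_mul, zero_mul, mul_zero, add_zero, sub_zero] at this
  linarith

theorem sqrt_div_mul_sqrt_div {p : ℝ} (hp : 0 < p) (hp1 : p < 1) :
    √((1 - p) / p) * √(p / (1 - p)) = 1 := by
  have hq : 0 < 1 - p := by linarith
  rw [← Real.sqrt_mul (by positivity), show (1 - p) / p * (p / (1 - p)) = 1 by field_simp,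
    Real.sqrt_one]

theorem le_mul_sqrt_of_asymmetry {p c A B : ℝ} (hp : 0 < p) (hp1 : p < 1) (hc : 0 < c)
    (hA : 0 < A) (hB : 0 < B) (hAB : A * B ≤ c ^ 2) (hr : B / A ≤ (1 - p) / p) :
    B ≤ c * √((1 - p) / p) := by
  have hq : 0 < 1 - p := by linarith
  refine (sq_le_sq₀ hB.le (by positivity)).1 ?_
  rw [mul_pow, Real.sq_sqrt (by positivity)]
  calc B ^ 2 = A * B * (B / A) := by field_simp
    _ ≤ c ^ 2 * ((1 - p) / p) := mul_le_mul hAB hr (by positivity) (by positivity)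

/-- The zero-mean two-point distribution on `{-A, B}` is dominated by `c BS`. -/
theorem F3.two_point_le_stepBS {p c A B : ℝ} (hp : 0 < p) (hp1 : p < 1) (hc : 0 < c)
    (hA : 0 < A) (hB : 0 < B) (hAB : A * B ≤ c ^ 2) (hr : B / A ≤ (1 - p) / p) {f : ℝ → ℝ}
    (hf : f ∈ F3) (s : ℝ) :
    (B * f (s - A) + A * f (s + B)) / (A + B) ≤ stepBS p c f s := by
  have hq : 0 < 1 - p := by linarith
  have hBb := le_mul_sqrt_of_asymmetry hp hp1 hc hA hB hAB hr
  obtain ⟨hα, hβ⟩ := sqrt_div_mul_self hp hp1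
  have hαβ := sqrt_div_mul_sqrt_div hp hp1
  have hβ0 : 0 < √(p / (1 - p)) := Real.sqrt_pos.2 (div_pos hp hq)
  rw [stepBS]
  set α := √((1 - p) / p)
  set β := √(p / (1 - p))
  -- v and v + w are the atoms of s + c BS. The quadratic tangent to f at v and meeting it at v + w
  -- lies above f on (-∞, v + w], so its expectation is governed by mean and variance alone.
  set v := s + c * -β with hv
  set w := c * (α + β) with hw
  have hα0 : 0 < α := by
    by_contra h
    nlinarith
  have hw0 : 0 < w := by positivity
  have hpw : p * w = c * β := by rw [hw]; linear_combination c * hα - c * hβ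
  have h1 := F3.taylor_quotient_le hf v (y := c * β - A) (w := w) (by nlinarith)
  have h2 := F3.taylor_quotient_le hf v (y := c * β + B) (w := w) (by rw [hw]; linarith)
  rw [show v + (c * β - A) = s - A by rw [hv]; ring] at h1
  rw [show v + (c * β + B) = s + B by rw [hv]; ring] at h2
  rw [show s + c * α = v + w by rw [hv, hw]; ring]
  have hκ : 0 ≤ f (v + w) - f v - deriv f v * w := by
    have := sub_le_sub_of_hasDerivAt_le (by linarith : v ≤ v + w)
      (fun x => hasDerivAt_quadratic (deriv f v) v 0 x) (F3.hasDerivAt hf)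
      (fun x hx => by simpa using F3.monotone_deriv hf hx.1)
    have e : deriv f v * (v + w - v) + 0 / 2 * (v + w - v) ^ 2 -
      (deriv f v * (v - v) + 0 / 2 * (v - v) ^ 2) = deriv f v * w := by ring
    linarith
  set κ := f (v + w) - f v - deriv f v * w with hκd
  rw [div_le_iff₀ (by positivity)]
  refine le_of_mul_le_mul_right ?_ (by positivity : 0 < w ^ 2)
  have h3 := mul_le_mul_of_nonneg_left h1 hB.le
  have h4 := mul_le_mul_of_nonneg_left h2 hA.le
  -- The two-point law has variance A B ≤ c², and the quadratic coefficient κ/w² is nonnegative.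
  have h5 : κ * (A * B) * (A + B) ≤ κ * c ^ 2 * (A + B) := by gcongr
  have e1 : p * f (v + w) + (1 - p) * f v = f v + deriv f v * (c * β) + p * κ := by
    rw [hκd]; linear_combination (deriv f v) * hpw
  rw [e1]
  have e2 : p * w ^ 2 = c ^ 2 + (c * β) ^ 2 := by
    rw [sq w, ← mul_assoc, hpw, hw]; linear_combination c ^ 2 * hαβ
  have e3 : (f v + deriv f v * (c * β) + p * κ) * (A + B) * w ^ 2 =
      (f v + deriv f v * (c * β)) * (A + B) * w ^ 2 + κ * (A + B) * (c ^ 2 + (c * β) ^ 2) := by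
    rw [← e2]; ring
  rw [e3]
  linarith

theorem F3.le_add_deriv_mul {f : ℝ → ℝ} (hf : f ∈ F3) (x y : ℝ) :
    f x + deriv f x * (y - x) ≤ f y := by
  have hq := hasDerivAt_quadratic (deriv f x) x 0
  rcases le_total x y with h | h
  · have := sub_le_sub_of_hasDerivAt_le h hq (F3.hasDerivAt hf)
      (fun u hu => by simpa using F3.monotone_deriv hf hu.1)
    simp at this
    linarith
  · have := sub_le_sub_of_hasDerivAt_le h (F3.hasDerivAt hf) hq
      (fun u hu => by simpa using F3.monotone_deriv hf hu.2)
    simp at this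
    linarith

/-- Slope of the chord of `f` over `[s - A, s + B]`. -/
noncomputable def chordSlope (f : ℝ → ℝ) (A B s : ℝ) : ℝ :=
  (f (s + B) - f (s - A)) / (A + B)

theorem F3.chordSlope_nonneg {f : ℝ → ℝ} (hf : f ∈ F3) {A B : ℝ} (hA : 0 < A) (hB : 0 < B)
    (s : ℝ) : 0 ≤ chordSlope f A B s :=
  div_nonneg (sub_nonneg.2 (hf.2.1 (by linarith))) (by linarith)

theorem F3.chordSlope_le {f : ℝ → ℝ} (hf : f ∈ F3) {A B : ℝ} (hA : 0 < A) (hB : 0 < B)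
    (s : ℝ) : chordSlope f A B s ≤ deriv f (s + B) := by
  rw [chordSlope, div_le_iff₀ (by linarith)]
  have := F3.le_add_deriv_mul hf (s + B) (s - A)
  linarith

/-- By convexity f lies below its chord over [s - A, s + B], whose value at s is the two-point mean.
The chord slope is nonnegative, so the linear term does not help an increment of nonpositive mean.
-/
theorem F3.le_stepBS_add {p c A B : ℝ} (hp : 0 < p) (hp1 : p < 1) (hc : 0 < c)
    (hA : 0 < A) (hB : 0 < B) (hAB : A * B ≤ c ^ 2) (hr : B / A ≤ (1 - p) / p) {f : ℝ → ℝ}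
    (hf : f ∈ F3) (s : ℝ) {x : ℝ} (hx : -A ≤ x) (hx' : x ≤ B) :
    f (s + x) ≤ stepBS p c f s + chordSlope f A B s * x := by
  have hAB0 : 0 < A + B := by linarith
  have h1 := F3.two_point_le_stepBS hp hp1 hc hA hB hAB hr hf s
  have h2 := hf.2.2.1.2 (Set.mem_univ (s - A)) (Set.mem_univ (s + B))
    (div_nonneg (by linarith) hAB0.le : 0 ≤ (B - x) / (A + B))
    (div_nonneg (by linarith) hAB0.le : 0 ≤ (x + A) / (A + B)) (by field_simp; ring)
  simp only [smul_eq_mul] at h2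
  rw [show (B - x) / (A + B) * (s - A) + (x + A) / (A + B) * (s + B) = s + x by
    field_simp; ring] at h2
  have e : (B - x) / (A + B) * f (s - A) + (x + A) / (A + B) * f (s + B) =
      (B * f (s - A) + A * f (s + B)) / (A + B) + chordSlope f A B s * x := by
    rw [chordSlope]; field_simp; ring
  linarith

theorem sMean_one {m : ℝ} (hm : 1 ≤ m) {c : Fin 1 → ℝ} (hc : ∀ i, 0 ≤ c i) :
    sMean m c = c 0 := by
  simp only [sMean, Fin.sum_univ_one, Nat.cast_one, div_one, one_mul]
  rw [← Real.rpow_mul (hc 0), mul_one_div_cancel (by positivity), Real.rpow_one]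

theorem sumBound_of_one_le {p m : ℝ} (hm : 1 ≤ m) (h : ∀ n : ℕ, 2 ≤ n → SumBound p m n) {n : ℕ}
    (hn : 1 ≤ n) : SumBound p m n := by
  rcases hn.eq_or_lt with rfl | hn
  · intro f hf c hc
    rw [sMean_one hm hc]
    refine le_of_eq (congrArg _ (funext fun i => ?_))
    rw [Subsingleton.elim i 0]
  · exact h n hn

/-! ### Independent summands -/

section Independent

theorem exists_abs_le_of_ae_mem {μ : Measure ℝ} {a b : ℝ}
    (h : ∀ᵐ x ∂μ, -a ≤ x ∧ x ≤ b) : ∃ R : ℝ, ∀ᵐ x ∂μ, |x| ≤ R := by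
  refine ⟨max |a| |b|, h.mono fun x hx => ?_⟩
  rw [abs_le]
  exact ⟨by linarith [le_max_left |a| |b|, le_abs_self a], by
    linarith [le_max_right |a| |b|, le_abs_self b]⟩

theorem integrable_of_ae_abs_le {μ : Measure ℝ} [IsProbabilityMeasure μ]
    (h : ∃ R : ℝ, ∀ᵐ x ∂μ, |x| ≤ R) {f : ℝ → ℝ} (hf : Continuous f) : Integrable f μ := by
  obtain ⟨R, hR⟩ := h
  obtain ⟨C, hC⟩ := isCompact_Icc.exists_bound_of_continuousOn (s := Set.Icc (-R) R)
    hf.continuousOn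
  exact Integrable.of_bound hf.aestronglyMeasurable C (hR.mono fun x hx => hC x (abs_le.1 hx))

/-- Replace one summand at a time by its Bernoulli majorant; the induction runs over all f because
each replacement turns f into `stepBS p (c 0) f`. -/
theorem integral_pi_le_expBS {p : ℝ} (hp : 0 < p) (hp1 : p < 1) {n : ℕ}
    {μ : Fin n → Measure ℝ} [∀ i, IsProbabilityMeasure (μ i)] {a b c : Fin n → ℝ}
    (hmean : ∀ i, ∫ x, x ∂(μ i) ≤ 0) (ha : ∀ i, 0 < a i) (hb : ∀ i, 0 < b i)
    (hc : ∀ i, 0 < c i) (hμ : ∀ i, ∀ᵐ x ∂(μ i), -a i ≤ x ∧ x ≤ b i)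
    (hab : ∀ i, a i * b i ≤ c i ^ 2) (hr : ∀ i, b i / a i ≤ (1 - p) / p)
    {f : ℝ → ℝ} (hf : f ∈ F3) :
    ∫ x, f (∑ i, x i) ∂(Measure.pi μ) ≤ expBS p f c := by
  induction n generalizing f with
  | zero => rw [Measure.pi_of_empty, integral_dirac, expBS_zero]; simp
  | succ n ih =>
    have hbd := fun i => exists_abs_le_of_ae_mem (hμ i)
    have hfc := F3.continuous hf
    have hsf := stepBS_mem_F3 hp.le hp1.le (c 0) hf
    have hint : Integrable (fun x : Fin (n + 1) → ℝ => f (∑ i, x i)) (Measure.pi μ) :=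
      integrable_pi_of_continuous hbd (by fun_prop)
    rw [integral_pi_succ hint, expBS_succ hp.le hp1.le hfc]
    refine le_trans ?_ (ih (μ := fun i => μ i.succ) (fun i => hmean _) (fun i => ha _)
      (fun i => hb _) (fun i => hc _) (fun i => hμ _) (fun i => hab _) (fun i => hr _) hsf)
    have hstep : ∀ y : Fin n → ℝ, ∫ x, f (∑ i, (Fin.cons x y : Fin (n + 1) → ℝ) i) ∂(μ 0) ≤
        stepBS p (c 0) f (∑ i, y i) := by
      intro y
      have hi : Integrable (fun x : ℝ => x) (μ 0) := integrable_of_ae_abs_le (hbd 0) continuous_id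
      calc ∫ x, f (∑ i, (Fin.cons x y : Fin (n + 1) → ℝ) i) ∂(μ 0)
          ≤ ∫ x, (stepBS p (c 0) f (∑ i, y i) +
              chordSlope f (a 0) (b 0) (∑ i, y i) * x) ∂(μ 0) := by
            refine integral_mono_ae ?_ ((integrable_const _).add (hi.const_mul _)) ?_
            · refine integrable_of_ae_abs_le (hbd 0) ?_
              simp only [Fin.sum_univ_succ, Fin.cons_zero, Fin.cons_succ]
              fun_prop
            · filter_upwards [hμ 0] with x hx
              simp only [Fin.sum_univ_succ, Fin.cons_zero, Fin.cons_succ]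
              rw [add_comm x]
              exact F3.le_stepBS_add hp hp1 (hc 0) (ha 0) (hb 0) (hab 0) (hr 0) hf _ hx.1 hx.2
        _ = stepBS p (c 0) f (∑ i, y i) +
              chordSlope f (a 0) (b 0) (∑ i, y i) * ∫ x, x ∂(μ 0) := by
            rw [integral_add (integrable_const _) (hi.const_mul _), integral_const_mul]
            simp
        _ ≤ stepBS p (c 0) f (∑ i, y i) := by
            have := mul_nonneg (F3.chordSlope_nonneg hf (ha 0) (hb 0) (∑ i, y i))
              (neg_nonneg.2 (hmean 0))
            linarith
    have hcs := F3.continuous hsf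
    refine integral_mono ?_ (integrable_pi_of_continuous (fun i => hbd _) (by fun_prop)) hstep
    have h := (measurePreserving_piFinSuccAbove μ 0).symm
    have h2 := ((h.integrable_comp_emb (MeasurableEquiv.measurableEmbedding _)).2
      hint).integral_prod_right
    simp only [Function.comp_def, MeasurableEquiv.piFinSuccAbove_symm_apply, Fin.insertNthEquiv,
      Fin.zero_succAbove, Equiv.coe_fn_mk, Fin.insertNth_zero] at h2
    exact h2

theorem SumBound.indepBound {p m : ℝ} (hp : 0 < p) (hp1 : p < 1) {n : ℕ}
    (h : SumBound p m n) : IndepBound.{u} p m n := by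
  intro Ω _ P _ X a b hX hind hmean ha hb hab hr f hf
  have hfc := F3.continuous hf
  have hμ : ∀ i, IsProbabilityMeasure (P.map (X i)) := fun i =>
    Measure.isProbabilityMeasure_map (hX i).aemeasurable
  have hXm : AEMeasurable (fun ω i => X i ω) P := (measurable_pi_lambda _ hX).aemeasurable
  have hmap := (iIndepFun_iff_map_fun_eq_pi_map fun i => (hX i).aemeasurable).1 hind
  have hab' : ∀ i, ∀ᵐ x ∂(P.map (X i)), -a i ≤ x ∧ x ≤ b i := fun i => by
    rw [ae_map_iff (hX i).aemeasurable measurableSet_Icc]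
    exact hab i
  have hfs : Continuous fun x : Fin n → ℝ => f (∑ i, x i) := by fun_prop
  have hc : ∀ i, 0 < √(a i * b i) := fun i => Real.sqrt_pos.2 (mul_pos (ha i) (hb i))
  constructor
  · have := integrable_pi_of_continuous (fun i => exists_abs_le_of_ae_mem (hab' i)) hfs
    rw [← hmap] at this
    exact this.comp_aemeasurable hXm
  · have h1 := integral_pi_le_expBS (μ := fun i => P.map (X i)) hp hp1
      (c := fun i => √(a i * b i)) (fun i => by
        rw [integral_map (hX i).aemeasurable (by fun_prop)]; exact hmean i) ha hb hc hab'
      (fun i => (Real.sq_sqrt (mul_pos (ha i) (hb i)).le).ge) hr hf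
    rw [← hmap, integral_map hXm hfs.aestronglyMeasurable] at h1
    refine h1.trans ((h f hf _ fun i => (hc i).le).trans_eq ?_)
    congr 1
    funext _
    rw [sMean]
    congr 2
    refine Finset.sum_congr rfl fun i _ => ?_
    rw [Real.rpow_mul (hc i).le, Real.rpow_two, Real.sq_sqrt (mul_pos (ha i) (hb i)).le]

end Independent

/-! ### Supermartingales -/

section Supermartingale

theorem stepBS_comm (p a b : ℝ) (f : ℝ → ℝ) :
    stepBS p a (stepBS p b f) = stepBS p b (stepBS p a f) := by
  funext x
  simp only [stepBS, add_right_comm x]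
  ring

theorem expBS_succ_last {p : ℝ} (hp : 0 ≤ p) (hp1 : p ≤ 1) {f : ℝ → ℝ} (hf : Continuous f) {n : ℕ}
    (c : Fin (n + 1) → ℝ) :
    expBS p f c = expBS p (stepBS p (c (Fin.last n)) f) (Fin.init c) := by
  induction n generalizing f with
  | zero =>
    rw [expBS_succ hp hp1 hf, expBS_zero, expBS_zero]
    rfl
  | succ n ih =>
    rw [expBS_succ hp hp1 hf, ih (continuous_stepBS hf _),
      expBS_succ hp hp1 (continuous_stepBS hf _) (Fin.init c), ← Fin.tail_init_eq_init_tail,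
      stepBS_comm]
    rfl

variable {Ω : Type u} {mΩ : MeasurableSpace Ω} {P : Measure Ω} [IsProbabilityMeasure P]

/-- No lower bound on Z is needed: f lies above its tangent at K, which is integrable along Z, and
f(Z) ≤ f(K) almost surely. -/
theorem F3.integrable_comp {f : ℝ → ℝ} (hf : f ∈ F3) {Z : Ω → ℝ} (hZ : Integrable Z P) {K : ℝ}
    (hK : ∀ᵐ ω ∂P, Z ω ≤ K) : Integrable (fun ω => f (Z ω)) P := by
  refine integrable_of_le_of_le
    ((F3.continuous hf).comp_aestronglyMeasurable hZ.aestronglyMeasurable)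
    (Filter.Eventually.of_forall fun ω => F3.le_add_deriv_mul hf K (Z ω))
    (hK.mono fun ω hω => hf.2.1 hω)
    ((integrable_const _).add ((hZ.sub (integrable_const K)).const_mul _)) (integrable_const _)

theorem integral_mul_nonpos_of_condExp_nonpos {m : MeasurableSpace Ω} (hm : m ≤ mΩ)
    {l D : Ω → ℝ} (hl : StronglyMeasurable[m] l) (hD : Integrable D P)
    (hlD : Integrable (l * D) P) (hl0 : ∀ᵐ ω ∂P, 0 ≤ l ω) (h : P[D|m] ≤ᵐ[P] 0) :
    ∫ ω, l ω * D ω ∂P ≤ 0 := by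
  have h1 := condExp_mul_of_stronglyMeasurable_left hl hlD hD
  have h2 : ∫ ω, l ω * D ω ∂P = ∫ ω, (P[l * D|m]) ω ∂P := (integral_condExp hm).symm
  rw [h2]
  refine integral_nonpos_of_ae ?_
  filter_upwards [h1, hl0, h] with ω e1 e2 e3
  rw [e1]
  exact mul_nonpos_of_nonneg_of_nonpos e2 e3

/-- The chord slope is measurable with respect to the past and nonnegative, so its product with the
increment integrates to something nonpositive. The upper bound K keeps the slope bounded, since B ≤
c √((1 - p)/p) even though A may be unbounded. -/
theorem integral_step_le {p c K : ℝ} (hp : 0 < p) (hp1 : p < 1) (hc : 0 < c)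
    {m : MeasurableSpace Ω} (hm : m ≤ mΩ) {Y Z A B : Ω → ℝ} (hY : StronglyMeasurable[m] Y)
    (hYi : Integrable Y P) (hZi : Integrable Z P) (hYZ : P[Z|m] ≤ᵐ[P] Y)
    (hA : Measurable[m] A) (hB : Measurable[m] B)
    (h : ∀ᵐ ω ∂P, 0 < A ω ∧ 0 < B ω ∧ -A ω ≤ Z ω - Y ω ∧ Z ω - Y ω ≤ B ω ∧
      A ω * B ω ≤ c ^ 2 ∧ B ω / A ω ≤ (1 - p) / p) (hYK : ∀ᵐ ω ∂P, Y ω ≤ K)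
    {f : ℝ → ℝ} (hf : f ∈ F3) :
    (∀ᵐ ω ∂P, Z ω ≤ K + c * √((1 - p) / p)) ∧
      ∫ ω, f (Z ω) ∂P ≤ ∫ ω, stepBS p c f (Y ω) ∂P := by
  have hsf := stepBS_mem_F3 hp.le hp1.le c hf
  have hB' : ∀ᵐ ω ∂P, B ω ≤ c * √((1 - p) / p) := by
    filter_upwards [h] with ω ⟨h1, h2, _, _, h5, h6⟩
    exact le_mul_sqrt_of_asymmetry hp hp1 hc h1 h2 h5 h6
  have hZK : ∀ᵐ ω ∂P, Z ω ≤ K + c * √((1 - p) / p) := by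
    filter_upwards [h, hB', hYK] with ω ⟨_, _, _, h4, _, _⟩ h7 h8
    linarith
  refine ⟨hZK, ?_⟩
  set l : Ω → ℝ := fun ω => chordSlope f (A ω) (B ω) (Y ω) with hl
  have hfm : Measurable f := (F3.continuous hf).measurable
  have hlm : StronglyMeasurable[m] l := by
    apply Measurable.stronglyMeasurable
    have hYm := hY.measurable
    exact ((hfm.comp (hYm.add hB)).sub (hfm.comp (hYm.sub hA))).div (hA.add hB)
  have hl0 : ∀ᵐ ω ∂P, 0 ≤ l ω := by
    filter_upwards [h] with ω hω
    exact F3.chordSlope_nonneg hf hω.1 hω.2.1 _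
  have hlb : ∀ᵐ ω ∂P, ‖l ω‖ ≤ deriv f (K + c * √((1 - p) / p)) := by
    filter_upwards [h, hl0, hB', hYK] with ω hω h0 h7 h8
    rw [Real.norm_of_nonneg h0]
    exact (F3.chordSlope_le hf hω.1 hω.2.1 _).trans (F3.monotone_deriv hf (by linarith))
  have hD : Integrable (Z - Y) P := hZi.sub hYi
  have hlD : Integrable (l * (Z - Y)) P := hD.bdd_mul (hlm.mono hm).aestronglyMeasurable hlb
  have hcond : P[Z - Y|m] ≤ᵐ[P] 0 := by
    filter_upwards [condExp_sub hZi hYi m, hYZ] with ω h1 h2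
    rw [h1, Pi.sub_apply, condExp_of_stronglyMeasurable hm hY hYi]
    simpa using h2
  have hstepI := F3.integrable_comp hsf hYi hYK
  calc ∫ ω, f (Z ω) ∂P ≤ ∫ ω, (stepBS p c f (Y ω) + l ω * (Z - Y) ω) ∂P := by
        refine integral_mono_ae (F3.integrable_comp hf hZi hZK) (hstepI.add hlD) ?_
        filter_upwards [h] with ω ⟨h1, h2, h3, h4, h5, h6⟩
        have := F3.le_stepBS_add hp hp1 hc h1 h2 h5 h6 hf (Y ω) h3 h4
        rwa [add_sub_cancel] at this
    _ = ∫ ω, stepBS p c f (Y ω) ∂P + ∫ ω, l ω * (Z - Y) ω ∂P := integral_add hstepI hlD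
    _ ≤ ∫ ω, stepBS p c f (Y ω) ∂P := by
        have := integral_mul_nonpos_of_condExp_nonpos hm hlm hD hlD hl0 hcond
        linarith

theorem Supermartingale.integral_le_expBS {p : ℝ} (hp : 0 < p) (hp1 : p < 1)
    {H : Filtration ℕ mΩ} {S : ℕ → Ω → ℝ} (hS : Supermartingale S H P)
    (hS0 : ∀ᵐ ω ∂P, S 0 ω ≤ 0) {n : ℕ} {A B : Fin n → Ω → ℝ} {c : Fin n → ℝ}
    (hA : ∀ i : Fin n, Measurable[H (i : ℕ)] (A i))
    (hB : ∀ i : Fin n, Measurable[H (i : ℕ)] (B i)) (hc : ∀ i, 0 < c i)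
    (h : ∀ i : Fin n, ∀ᵐ ω ∂P, 0 < A i ω ∧ 0 < B i ω ∧
      -A i ω ≤ S ((i : ℕ) + 1) ω - S (i : ℕ) ω ∧ S ((i : ℕ) + 1) ω - S (i : ℕ) ω ≤ B i ω ∧
      A i ω * B i ω ≤ c i ^ 2 ∧ B i ω / A i ω ≤ (1 - p) / p) :
    (∃ K : ℝ, ∀ᵐ ω ∂P, S n ω ≤ K) ∧ ∀ f ∈ F3, ∫ ω, f (S n ω) ∂P ≤ expBS p f c := by
  induction n with
  | zero =>
    refine ⟨⟨0, hS0⟩, fun f hf => ?_⟩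
    rw [expBS_zero]
    calc ∫ ω, f (S 0 ω) ∂P ≤ ∫ ω, f 0 ∂P :=
          integral_mono_ae (F3.integrable_comp hf (hS.2.2 0) hS0) (integrable_const _)
            (hS0.mono fun ω hω => hf.2.1 hω)
      _ = f 0 := by simp
  | succ n ih =>
    obtain ⟨⟨K, hK⟩, ihf⟩ := ih (A := fun i => A i.castSucc) (B := fun i => B i.castSucc)
      (c := Fin.init c) (fun i => hA i.castSucc) (fun i => hB i.castSucc) (fun i => hc _)
      (fun i => h i.castSucc)
    have key := fun f hf => integral_step_le hp hp1 (hc (Fin.last n)) (H.le n) (hS.1 n) (hS.2.2 n)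
      (hS.2.2 (n + 1)) (hS.2.1 n (n + 1) n.le_succ) (hA (Fin.last n)) (hB (Fin.last n))
      (h (Fin.last n)) hK (f := f) hf
    -- The almost sure bound does not depend on f; any member of `F3` serves here.
    refine ⟨⟨_, (key _ (max_pow_three_mem_F3 0)).1⟩, fun f hf => ?_⟩
    rw [expBS_succ_last hp.le hp1.le (F3.continuous hf)]
    exact (key f hf).2.trans (ihf _ (stepBS_mem_F3 hp.le hp1.le _ hf))

theorem SumBound.supermartingaleBound {p m : ℝ} (hp : 0 < p) (hp1 : p < 1) {n : ℕ}
    (h : SumBound p m n) : SupermartingaleBound.{u} p m n := by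
  intro Ω mΩ P _ H S A B c hS hS0 hA hB hAB f hf
  have hc : ∀ i, 0 < c i := fun i => by
    obtain ⟨ω, h1, h2, -, -, h5, -⟩ := (hAB i).exists
    exact (Real.sqrt_pos.2 (mul_pos h1 h2)).trans_le h5
  obtain ⟨⟨K, hK⟩, hle⟩ := Supermartingale.integral_le_expBS hp hp1 hS hS0 hA hB hc (fun i => by
    filter_upwards [hAB i] with ω ⟨h1, h2, h3, h4, h5, h6⟩
    exact ⟨h1, h2, h3, h4, (Real.sqrt_le_left (hc i).le).1 h5, h6⟩)
  exact ⟨F3.integrable_comp hf (hS.2.2 n) hK, (hle f hf).trans (h f hf c fun i => (hc i).le)⟩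

end Supermartingale

/-! ### Bernoulli models that recover the two-summand bound -/

theorem exists_iid_stdBernoulli {p : ℝ} (hp : 0 ≤ p) (hp1 : p ≤ 1) (n : ℕ) :
    ∃ (Ω : Type u) (_ : MeasurableSpace Ω) (P : Measure Ω) (X : Fin n → Ω → ℝ),
      IsProbabilityMeasure P ∧ (∀ i, Measurable (X i)) ∧ iIndepFun X P ∧
      ∀ i, P.map (X i) = stdBernoulli p := by
  have := isProbabilityMeasure_stdBernoulli hp hp1
  set μ := Measure.pi fun _ : Fin n => stdBernoulli p with hμ
  have hup : Measurable (ULift.up.{u} : (Fin n → ℝ) → _) := measurable_up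
  have hP := Measure.isProbabilityMeasure_map (μ := μ) hup.aemeasurable
  have hX : ∀ i, Measurable fun ω : ULift.{u} (Fin n → ℝ) => ω.down i := fun i =>
    (measurable_pi_apply i).comp measurable_down
  have hmap : ∀ i, (μ.map ULift.up.{u}).map (fun ω => ω.down i) = stdBernoulli p := by
    intro i
    rw [Measure.map_map (hX i) hup]
    exact (measurePreserving_eval (fun _ : Fin n => stdBernoulli p) i).map_eq
  refine ⟨ULift.{u} (Fin n → ℝ), inferInstance, μ.map ULift.up, fun i ω => ω.down i, hP, hX, ?_,
    hmap⟩
  rw [iIndepFun_iff_map_fun_eq_pi_map fun i => (hX i).aemeasurable,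
    Measure.map_map (measurable_pi_lambda _ hX) hup]
  simp only [hmap]
  exact Measure.map_id

theorem integral_id_stdBernoulli {p : ℝ} (hp : 0 < p) (hp1 : p < 1) :
    ∫ x, x ∂(stdBernoulli p) = 0 := by
  obtain ⟨h1, h2⟩ := sqrt_div_mul_self hp hp1
  rw [integral_stdBernoulli hp.le hp1.le]
  linarith

section Model

variable {Ω : Type u} {mΩ : MeasurableSpace Ω} {P : Measure Ω} {p : ℝ}

theorem integral_comp_eq_expBS [IsProbabilityMeasure P] {n : ℕ} {X : Fin n → Ω → ℝ} (hX : ∀ i, Measurable (X i))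
    (hind : iIndepFun X P) (hlaw : ∀ i, P.map (X i) = stdBernoulli p) {f : ℝ → ℝ}
    (hf : Continuous f) (c : Fin n → ℝ) :
    ∫ ω, f (∑ i, c i * X i ω) ∂P = expBS p f c := by
  have hmap := (iIndepFun_iff_map_fun_eq_pi_map fun i => (hX i).aemeasurable).1 hind
  simp only [hlaw] at hmap
  have hfs : Continuous fun x : Fin n → ℝ => f (∑ i, c i * x i) := by fun_prop
  rw [expBS, ← hmap, integral_map (measurable_pi_lambda _ hX).aemeasurable
    hfs.aestronglyMeasurable]

theorem ae_of_map_eq_stdBernoulli {X : Ω → ℝ} (hX : Measurable X)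
    (hlaw : P.map X = stdBernoulli p) :
    ∀ᵐ ω ∂P, -√(p / (1 - p)) ≤ X ω ∧ X ω ≤ √((1 - p) / p) := by
  have : ∀ᵐ x ∂(P.map X), -√(p / (1 - p)) ≤ x ∧ x ≤ √((1 - p) / p) := by
    have h1 := Real.sqrt_nonneg (p / (1 - p))
    have h2 := Real.sqrt_nonneg ((1 - p) / p)
    rw [hlaw]
    exact ae_stdBernoulli ⟨by linarith, le_rfl⟩ ⟨le_rfl, by linarith⟩
  exact (ae_map_iff hX.aemeasurable measurableSet_Icc).1 this

theorem integral_of_map_eq_stdBernoulli (hp : 0 < p) (hp1 : p < 1) {X : Ω → ℝ}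
    (hX : Measurable X) (hlaw : P.map X = stdBernoulli p) : ∫ ω, X ω ∂P = 0 := by
  have := integral_map (μ := P) hX.aemeasurable (f := fun x : ℝ => x) (by fun_prop)
  rw [← this, hlaw, integral_id_stdBernoulli hp hp1]

theorem integrable_of_map_eq_stdBernoulli [IsProbabilityMeasure P] {X : Ω → ℝ} (hX : Measurable X)
    (hlaw : P.map X = stdBernoulli p) : Integrable X P := by
  obtain ⟨R, hR⟩ := exists_abs_le_of_ae_mem (μ := P.map X) (a := √(p / (1 - p)))
    (b := √((1 - p) / p))
    ((ae_map_iff hX.aemeasurable measurableSet_Icc).2 (ae_of_map_eq_stdBernoulli hX hlaw))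
  exact Integrable.of_bound hX.aestronglyMeasurable R (ae_of_ae_map hX.aemeasurable hR)

end Model

theorem sqrt_div_div_sqrt_div {p : ℝ} (hp : 0 < p) (hp1 : p < 1) {c : ℝ} (hc : 0 < c) :
    c * √((1 - p) / p) / (c * √(p / (1 - p))) = (1 - p) / p := by
  have hq : 0 < 1 - p := by linarith
  rw [mul_div_mul_left _ _ hc.ne', ← Real.sqrt_div (by positivity),
    show (1 - p) / p / (p / (1 - p)) = ((1 - p) / p) ^ 2 by field_simp,
    Real.sqrt_sq (by positivity)]

/-- The variables c i BS i are an extremal instance: a i b i = (c i)² and b i / a i = (1 - p)/p.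
Positivity of a i and b i is why the coefficients must be positive. -/
theorem IndepBound.expBS_le {p m : ℝ} (hp : 0 < p) (hp1 : p < 1) {n : ℕ}
    (h : IndepBound.{u} p m n) {f : ℝ → ℝ} (hf : f ∈ F3) {c : Fin n → ℝ} (hc : ∀ i, 0 < c i) :
    expBS p f c ≤ expBS p f (fun _ : Fin n => sMean m c) := by
  have hq : 0 < 1 - p := by linarith
  obtain ⟨Ω, mΩ, P, X, hP, hX, hind, hlaw⟩ := exists_iid_stdBernoulli.{u} hp.le hp1.le n
  have hβ : 0 < √(p / (1 - p)) := Real.sqrt_pos.2 (div_pos hp hq)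
  have hα : 0 < √((1 - p) / p) := Real.sqrt_pos.2 (div_pos hq hp)
  have key := (h Ω P (fun i ω => c i * X i ω) (fun i => c i * √(p / (1 - p)))
    (fun i => c i * √((1 - p) / p)) (fun i => (hX i).const_mul _)
    (hind.comp (fun i x => c i * x) fun i => measurable_const_mul (c i))
    (fun i => by
      rw [integral_const_mul, integral_of_map_eq_stdBernoulli hp hp1 (hX i) (hlaw i), mul_zero])
    (fun i => mul_pos (hc i) hβ) (fun i => mul_pos (hc i) hα)
    (fun i => by
      filter_upwards [ae_of_map_eq_stdBernoulli (hX i) (hlaw i)] with ω hω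
      rw [← mul_neg]
      exact ⟨mul_le_mul_of_nonneg_left hω.1 (hc i).le, mul_le_mul_of_nonneg_left hω.2 (hc i).le⟩)
    (fun i => (sqrt_div_div_sqrt_div hp hp1 (hc i)).le) f hf).2
  rw [integral_comp_eq_expBS hX hind hlaw (F3.continuous hf) c] at key
  refine key.trans_eq ?_
  congr 1
  funext _
  rw [sMean]
  congr 2
  refine Finset.sum_congr rfl fun i _ => ?_
  rw [Real.rpow_mul (hc i).le, Real.rpow_two]
  congr 1
  linear_combination c i ^ 2 * sqrt_div_mul_sqrt_div hp hp1

/-- The filtration `⊥ ≤ σ(X) ≤ ⊤ ≤ ⊤ ≤ ⋯`. -/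
def twoStepFiltration {Ω : Type u} [mΩ : MeasurableSpace Ω] {X : Ω → ℝ} (hX : Measurable X) :
    Filtration ℕ mΩ where
  seq
    | 0 => ⊥
    | 1 => MeasurableSpace.comap X inferInstance
    | _ + 2 => mΩ
  mono' := by
    refine monotone_nat_of_le_succ fun n => ?_
    match n with
    | 0 => exact bot_le
    | 1 => exact hX.comap_le
    | _ + 2 => exact le_rfl
  le' n := by
    match n with
    | 0 => exact bot_le
    | 1 => exact hX.comap_le
    | _ + 2 => exact le_rfl

/-- The partial sums `0, X, X + Y, X + Y, …`. -/
def twoStepSum {Ω : Type u} (X Y : Ω → ℝ) : ℕ → Ω → ℝ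
  | 0 => 0
  | 1 => X
  | _ + 2 => X + Y

theorem supermartingale_twoStepSum {Ω : Type u} [mΩ : MeasurableSpace Ω] {P : Measure Ω}
    [IsProbabilityMeasure P] {X Y : Ω → ℝ} (hX : Measurable X) (hY : Measurable Y)
    (hXi : Integrable X P) (hYi : Integrable Y P) (hX0 : ∫ ω, X ω ∂P = 0)
    (hY0 : ∫ ω, Y ω ∂P = 0) (hind : IndepFun Y X P) :
    Supermartingale (twoStepSum X Y) (twoStepFiltration hX) P := by
  have hXm : StronglyMeasurable[MeasurableSpace.comap X inferInstance] X :=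
    (comap_measurable X).stronglyMeasurable
  refine supermartingale_nat (fun n => ?_) (fun n => ?_) (fun n => ?_)
  · match n with
    | 0 => exact stronglyMeasurable_zero
    | 1 => exact hXm
    | _ + 2 => exact (hX.add hY).stronglyMeasurable
  · match n with
    | 0 => exact integrable_zero _ _ _
    | 1 => exact hXi
    | _ + 2 => exact hXi.add hYi
  · match n with
    | 0 =>
      change P[X|⊥] ≤ᵐ[P] 0
      rw [condExp_bot, hX0]
      exact Filter.EventuallyLE.rfl
    | 1 =>
      change P[X + Y|MeasurableSpace.comap X inferInstance] ≤ᵐ[P] X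
      have h1 := condExp_indep_eq (μ := P) hY.comap_le hX.comap_le
        (comap_measurable Y).stronglyMeasurable hind
      filter_upwards [condExp_add hXi hYi (MeasurableSpace.comap X inferInstance), h1] with ω e1 e2
      rw [e1, Pi.add_apply, e2, hY0, condExp_of_stronglyMeasurable hX.comap_le hXm hXi]
      simp
    | n + 2 =>
      change P[X + Y|mΩ] ≤ᵐ[P] X + Y
      rw [condExp_of_stronglyMeasurable le_rfl (hX.add hY).stronglyMeasurable (hXi.add hYi)]

/-- Apply the bound to the martingale 0, c 0 BS 0, c 0 BS 0 + c 1 BS 1 with constant A and B, for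
which √(A B) = c i exactly. -/
theorem SupermartingaleBound.expBS_le {p m : ℝ} (hp : 0 < p) (hp1 : p < 1)
    (h : SupermartingaleBound.{u} p m 2) {f : ℝ → ℝ} (hf : f ∈ F3) {c : Fin 2 → ℝ}
    (hc : ∀ i, 0 < c i) : expBS p f c ≤ expBS p f (fun _ : Fin 2 => sMean m c) := by
  have hq : 0 < 1 - p := by linarith
  obtain ⟨Ω, mΩ, P, X, hP, hX, hind, hlaw⟩ := exists_iid_stdBernoulli.{u} hp.le hp1.le 2
  have hβ : 0 < √(p / (1 - p)) := Real.sqrt_pos.2 (div_pos hp hq)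
  have hα : 0 < √((1 - p) / p) := Real.sqrt_pos.2 (div_pos hq hp)
  have hm : ∀ i, Measurable fun ω => c i * X i ω := fun i => (hX i).const_mul _
  have hi : ∀ i, Integrable (fun ω => c i * X i ω) P := fun i =>
    (integrable_of_map_eq_stdBernoulli (hX i) (hlaw i)).const_mul _
  have h0 : ∀ i, ∫ ω, c i * X i ω ∂P = 0 := fun i => by
    rw [integral_const_mul, integral_of_map_eq_stdBernoulli hp hp1 (hX i) (hlaw i), mul_zero]
  have hind' : IndepFun (fun ω => c 1 * X 1 ω) (fun ω => c 0 * X 0 ω) P :=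
    (hind.comp (fun i x => c i * x) fun i => measurable_const_mul (c i)).indepFun (by decide)
  have key := (h Ω mΩ P (twoStepFiltration (hm 0)) (twoStepSum (fun ω => c 0 * X 0 ω)
    fun ω => c 1 * X 1 ω) (fun i _ => c i * √(p / (1 - p))) (fun i _ => c i * √((1 - p) / p)) c
    (supermartingale_twoStepSum (hm 0) (hm 1) (hi 0) (hi 1) (h0 0) (h0 1) hind')
    (Filter.Eventually.of_forall fun ω => le_rfl)
    (fun i => measurable_const) (fun i => measurable_const)
    (fun i => by
      filter_upwards [ae_of_map_eq_stdBernoulli (hX i) (hlaw i)] with ω hω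
      have hdiff : twoStepSum (fun ω => c 0 * X 0 ω) (fun ω => c 1 * X 1 ω) ((i : ℕ) + 1) ω -
          twoStepSum (fun ω => c 0 * X 0 ω) (fun ω => c 1 * X 1 ω) (i : ℕ) ω = c i * X i ω := by
        fin_cases i <;> simp [twoStepSum]
      rw [hdiff, ← mul_neg]
      refine ⟨mul_pos (hc i) hβ, mul_pos (hc i) hα, mul_le_mul_of_nonneg_left hω.1 (hc i).le,
        mul_le_mul_of_nonneg_left hω.2 (hc i).le, ?_, (sqrt_div_div_sqrt_div hp hp1 (hc i)).le⟩
      rw [show c i * √(p / (1 - p)) * (c i * √((1 - p) / p)) = c i ^ 2 by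
        linear_combination c i ^ 2 * sqrt_div_mul_sqrt_div hp hp1, Real.sqrt_sq (hc i).le])
    f hf).2
  refine le_trans (le_of_eq ?_) key
  rw [← integral_comp_eq_expBS hX hind hlaw (F3.continuous hf) c]
  simp [twoStepSum, Fin.sum_univ_two]

end BernoulliSums

/-! ### The equivalence -/

theorem mainTheorem1 (p m : ℝ) (hp0 : 0 < p) (hp1 : p < 1) (hm : 1 ≤ m) :
    List.TFAE
      [BernoulliSums.mStar p ≤ m,
        ∀ n : ℕ, 2 ≤ n → BernoulliSums.SumBound p m n,
        BernoulliSums.SumBound p m 2,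
        ∀ n : ℕ, 2 ≤ n → BernoulliSums.SumSchurConcave p m n,
        BernoulliSums.SumSchurConcave p m 2,
        ∀ n : ℕ, 1 ≤ n → BernoulliSums.IndepBound.{u} p m n,
        ∀ n : ℕ, 1 ≤ n → BernoulliSums.SupermartingaleBound.{u} p m n] := by
  open BernoulliSums in
  tfae_have 1 → 4 := fun h n _ => ((mStar_le_iff hp0 hm).1 h).sumSchurConcave hp0 hp1 hm n
  tfae_have 4 → 5 := fun h => h 2 le_rfl
  tfae_have 4 → 2 := fun h n hn => (h n hn).sumBound hm
  tfae_have 5 → 3 := fun h => h.sumBound hm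
  tfae_have 2 → 3 := fun h => h 2 le_rfl
  tfae_have 3 → 1 := fun h =>
    mStar_le_of_bound_two hp0 hp1 hm fun f hf c hc => h f hf c fun i => (hc i).le
  tfae_have 2 → 6 := fun h n hn => (sumBound_of_one_le hm h hn).indepBound hp0 hp1
  tfae_have 2 → 7 := fun h n hn => (sumBound_of_one_le hm h hn).supermartingaleBound hp0 hp1
  tfae_have 6 → 1 := fun h =>
    mStar_le_of_bound_two hp0 hp1 hm fun f hf c hc => (h 2 one_le_two).expBS_le hp0 hp1 hf hc
  tfae_have 7 → 1 := fun h =>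
    mStar_le_of_bound_two hp0 hp1 hm fun f hf c hc => (h 2 one_le_two).expBS_le hp0 hp1 hf hc
  tfae_finish
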